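/- Let $X$ be (the vertex set of) a locally finite, connected graph, possibly with multiple edges and loops. For $x\ne y$ let $e(x,y)$ be the number of edges between $x$ and $y$, let $e(x,x)$ be twice the number of loops at $x$, put $\deg(x)=\sum_y e(x,y)$, and let $d(\cdot,\cdot)$ be the graph metric. Suppose that the vertex degrees are bounded, $\sup_x \deg(x)<\infty$. Let $P=(p(x,y))_{x,y\in X}$ be the transition matrix of a random walk (Markov chain) on $X$, with $n$-step transition probabilities $p^{(n)}(x,y)$, such that - $P$ is uniformly irreducible: there are constants $K,\varepsilon_0>0$ such that for any neighbours $x,y$ there is an integer $0\le k\le K$ with $p^{(k)}(x,y)\ge\varepsilon_0$; - $P$ has bounded range: there is $R>0$ such that $p(x,y)>0$ only if $d(x,y)\le R$; - $P$ has an invariant measure $\nu$, that is, $\sum_x \nu(x)p(x,y)=\nu(y)$ for all $y\in X$, which satisfies $C^{-1}\le\nu(x)\le C$ for all $x\in X$ and some constant $C\ge 1$. Let $P$ act by $PF(x)=\sum_y p(x,y)F(y)$ on the real Hilbert space $\ell^2(X,\nu)$ with inner product $\langle F,G\rangle=\sum_x F(x)G(x)\nu(x)$. Then the limit $\rho_2(P)=\lim_{n\to\infty}\|P^n\|^{1/n}$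 of operator norms exists, and $$\rho_2(P)=1 \iff X \text{ is amenable},$$ where $X$ is called amenable if $$\iota(X)=\inf\left\{\frac{\mathrm{Area}(F)}{\mathrm{Vol}(F)} : F\subset X \text{ finite and non-empty}\right\}=0 .$$ Here $\mathrm{Vol}(F)=\sum_{x\in F}\deg(x)$ and $\mathrm{Area}(F)$ is the number of edges with one endpoint in $F$ and the other in $X\setminus F$ (for a single vertex without edges the quotient $0/0$ is read as $0$). -/

import Mathlib

open Filter Topology MeasureTheory
open scoped ENNReal

namespace RandomWalkGraph

section Graphs

variable {α β : Type*}

/-- Local finiteness: every vertex is incident with only finitely many edges. -/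
def LocallyFinite (G : Graph α β) : Prop :=
  ∀ x : α, {e : β | G.Inc e x}.Finite

/-- The number `e(x,y)` of edges between `x` and `y` if `x ≠ y`; twice the number of loops
at `x` if `x = y`. -/
noncomputable def edgeCount (G : Graph α β) (x y : α) : ℕ :=
  open Classical in
  if x = y then 2 * {e : β | G.IsLoopAt e x}.ncard else {e : β | G.IsLink e x y}.ncard

/-- The degree `deg(x) = ∑_y e(x,y)` (a finite sum in a locally finite graph). -/
noncomputable def degree (G : Graph α β) (x : G.vertexSet) : ℕ :=
  ∑ᶠ y : G.vertexSet, edgeCount G x y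

/-- The simple graph on the vertices of `G` obtained by forgetting loops and multiplicities.
It has the same connectivity and the same graph metric as the multigraph `G`. -/
def underlying (G : Graph α β) : SimpleGraph G.vertexSet where
  Adj x y := x ≠ y ∧ G.Adj (x : α) (y : α)
  symm := ⟨fun _ _ h => ⟨h.1.symm, h.2.symm⟩⟩
  loopless := ⟨fun _ h => h.1 rfl⟩

/-- `Vol(F)` is the sum of the degrees of the vertices in `F`. -/
noncomputable def vol (G : Graph α β) (F : Finset G.vertexSet) : ℕ :=
  ∑ x ∈ F, degree G x

/-- `Area(F)` is the number of edges with one endpoint in `F` and the other one outside `F`. -/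
noncomputable def area (G : Graph α β) (F : Finset G.vertexSet) : ℕ :=
  {e : β | ∃ x y : G.vertexSet, x ∈ F ∧ y ∉ F ∧ G.IsLink e x y}.ncard

/-- The isoperimetric constant `ι(X)`, the infimum of `Area(F) / Vol(F)` over all non-empty
finite sets of vertices. (In a connected graph `Vol(F) = 0` only happens if the graph is a single
vertex without edges; the quotient is `0` in that case, as for any other finite graph `X = F`.) -/
noncomputable def isoperimetricConstant (G : Graph α β) : ℝ :=
  sInf {r : ℝ | ∃ F : Finset G.vertexSet, F.Nonempty ∧ r = (area G F : ℝ) / (vol G F : ℝ)}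

/-- A graph is amenable if its isoperimetric constant vanishes. -/
def Amenable (G : Graph α β) : Prop := isoperimetricConstant G = 0

end Graphs

section MarkovChains

variable {V : Type*}

/-- `P` is the transition matrix of a random walk (Markov chain) on `V`. -/
structure IsTransitionMatrix (P : V → V → ℝ) : Prop where
  nonneg : ∀ x y, 0 ≤ P x y
  hasSum_one : ∀ x, HasSum (P x) 1

/-- The `n`-step transition probabilities, i.e. the entries of the `n`-th matrix power. -/
noncomputable def nStep (P : V → V → ℝ) : ℕ → V → V → ℝ
  | 0 => fun x y => open Classical in if x = y then 1 else 0
  | n + 1 => fun x y => ∑' z, P x z * nStep P n z y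

/-- `ν` (given by its point masses, all of them positive) is an invariant measure of `P`. -/
structure IsInvariantMeasure (P : V → V → ℝ) (ν : V → ℝ) : Prop where
  pos : ∀ x, 0 < ν x
  hasSum : ∀ y, HasSum (fun x => ν x * P x y) (ν y)

/-- Uniform irreducibility with respect to a multigraph. -/
def UniformlyIrreducible {α β : Type*} (G : Graph α β)
    (P : G.vertexSet → G.vertexSet → ℝ) : Prop :=
  ∃ K : ℕ, ∃ ε₀ : ℝ, 0 < ε₀ ∧
    ∀ x y : G.vertexSet, G.Adj (x : α) (y : α) → ∃ k ≤ K, ε₀ ≤ nStep P k x y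

/-- Bounded range: steps of positive probability have uniformly bounded length in the graph
metric. -/
def BoundedRange {α β : Type*} (G : Graph α β)
    (P : G.vertexSet → G.vertexSet → ℝ) : Prop :=
  ∃ R : ℕ, ∀ x y : G.vertexSet, 0 < P x y → (underlying G).dist x y ≤ R

/-- The measure on (all subsets of) `V` with point masses `ν x`. -/
noncomputable def weightMeasure (ν : V → ℝ) : @Measure V ⊤ :=
  @Measure.sum V V ⊤ fun x => ENNReal.ofReal (ν x) • @Measure.dirac V ⊤ x

/-- The Hilbert space `ℓ²(V, ν)`, with `⟨F, G⟩ = ∑_x F(x) G(x) ν(x)`. -/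
abbrev L2 (ν : V → ℝ) : Type _ := @Lp V ℝ ⊤ _ 2 (weightMeasure ν)

theorem lintegral_weightMeasure (ν : V → ℝ) (f : V → ℝ≥0∞) :
    ∫⁻ x, f x ∂(weightMeasure ν) = ∑' x, ENNReal.ofReal (ν x) * f x := by
  let _ : MeasurableSpace V := ⊤
  rw [weightMeasure, lintegral_sum_measure]
  refine tsum_congr fun x => ?_
  rw [lintegral_smul_measure, lintegral_dirac' _ measurable_from_top, smul_eq_mul]

theorem ae_weightMeasure_iff {ν : V → ℝ} (hν : ∀ x, 0 < ν x) (p : V → Prop) :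
    (∀ᵐ x ∂(weightMeasure ν), p x) ↔ ∀ x, p x := by
  let _ : MeasurableSpace V := ⊤
  refine ⟨fun h x => ?_, fun h => Eventually.of_forall h⟩
  rw [ae_iff, ← lintegral_indicator_one MeasurableSpace.measurableSet_top,
    lintegral_weightMeasure, ENNReal.tsum_eq_zero] at h
  by_contra hx
  have := h x
  rw [Set.indicator_of_mem (by exact hx)] at this
  simp only [Pi.one_apply, mul_one, ENNReal.ofReal_eq_zero] at this
  exact absurd (hν x) (not_lt.2 this)

theorem eLpNorm_weightMeasure_sq (ν : V → ℝ) (f : V → ℝ) :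
    eLpNorm f 2 (weightMeasure ν) ^ 2 = ∑' x, ENNReal.ofReal (ν x) * ‖f x‖ₑ ^ 2 := by
  let _ : MeasurableSpace V := ⊤
  rw [← lintegral_weightMeasure]
  have := eLpNorm_nnreal_pow_eq_lintegral (μ := weightMeasure ν) (f := f) (p := 2) two_ne_zero
  simpa using this

theorem jensen_sq {P : V → V → ℝ} (hP : IsTransitionMatrix P) (f : V → ℝ) (x : V) :
    (∑' y, ENNReal.ofReal (P x y) * ‖f y‖ₑ) ^ 2 ≤ ∑' y, ENNReal.ofReal (P x y) * ‖f y‖ₑ ^ 2 := by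
  let _ : MeasurableSpace V := ⊤
  have hprob : IsProbabilityMeasure (weightMeasure (P x)) := by
    constructor
    rw [← lintegral_one, lintegral_weightMeasure]
    simp only [mul_one]
    rw [← ENNReal.ofReal_tsum_of_nonneg (hP.nonneg x) (hP.hasSum_one x).summable,
      (hP.hasSum_one x).tsum_eq, ENNReal.ofReal_one]
  have h := eLpNorm_le_eLpNorm_of_exponent_le (μ := weightMeasure (P x)) (f := f)
    (p := 1) (q := 2) (by norm_num) measurable_from_top.aestronglyMeasurable
  rw [eLpNorm_one_eq_lintegral_enorm, lintegral_weightMeasure] at h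
  rw [← eLpNorm_weightMeasure_sq]
  exact pow_le_pow_left₀ (by positivity) h 2

theorem contraction_sq {P : V → V → ℝ} (hP : IsTransitionMatrix P) {ν : V → ℝ}
    (hν : IsInvariantMeasure P ν) (f : V → ℝ) :
    ∑' x, ENNReal.ofReal (ν x) * (∑' y, ENNReal.ofReal (P x y) * ‖f y‖ₑ) ^ 2
      ≤ ∑' y, ENNReal.ofReal (ν y) * ‖f y‖ₑ ^ 2 := by
  calc _ ≤ ∑' x, ENNReal.ofReal (ν x) * ∑' y, ENNReal.ofReal (P x y) * ‖f y‖ₑ ^ 2 :=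
        ENNReal.tsum_le_tsum fun x => by gcongr; exact jensen_sq hP f x
    _ = ∑' y, (∑' x, ENNReal.ofReal (ν x * P x y)) * ‖f y‖ₑ ^ 2 := by
        simp_rw [← ENNReal.tsum_mul_left, ← ENNReal.tsum_mul_right]
        rw [ENNReal.tsum_comm]
        refine tsum_congr fun y => tsum_congr fun x => ?_
        rw [ENNReal.ofReal_mul (hν.pos x).le, mul_assoc]
    _ = _ := by
        refine tsum_congr fun y => ?_
        rw [← ENNReal.ofReal_tsum_of_nonneg
          (fun x => mul_nonneg (hν.pos x).le (hP.nonneg x y)) (hν.hasSum y).summable,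
          (hν.hasSum y).tsum_eq]

/-- The action `PF(x) = ∑_y p(x,y) F(y)` on functions. -/
noncomputable def act (P : V → V → ℝ) (f : V → ℝ) : V → ℝ := fun x => ∑' y, P x y * f y

theorem enorm_act_le {P : V → V → ℝ} (hP : IsTransitionMatrix P) (f : V → ℝ) (x : V) :
    ‖act P f x‖ₑ ≤ ∑' y, ENNReal.ofReal (P x y) * ‖f y‖ₑ := by
  refine (enorm_tsum_le_tsum_enorm).trans (le_of_eq (tsum_congr fun y => ?_))
  rw [enorm_mul, Real.enorm_of_nonneg (hP.nonneg x y)]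

theorem eLpNorm_act_le {P : V → V → ℝ} (hP : IsTransitionMatrix P) {ν : V → ℝ}
    (hν : IsInvariantMeasure P ν) (f : V → ℝ) :
    eLpNorm (act P f) 2 (weightMeasure ν) ≤ eLpNorm f 2 (weightMeasure ν) := by
  rw [← ENNReal.pow_le_pow_left_iff two_ne_zero, eLpNorm_weightMeasure_sq,
    eLpNorm_weightMeasure_sq]
  refine le_trans (ENNReal.tsum_le_tsum fun x => ?_) (contraction_sq hP hν f)
  gcongr
  exact enorm_act_le hP f x

theorem memLp_act {P : V → V → ℝ} (hP : IsTransitionMatrix P) {ν : V → ℝ}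
    (hν : IsInvariantMeasure P ν) {f : V → ℝ}
    (hf : MemLp f 2 (weightMeasure ν)) :
    MemLp (act P f) 2 (weightMeasure ν) := by
  let _ : MeasurableSpace V := ⊤
  exact ⟨measurable_from_top.aestronglyMeasurable, (eLpNorm_act_le hP hν f).trans_lt hf.2⟩

theorem summable_act {P : V → V → ℝ} (hP : IsTransitionMatrix P) {ν : V → ℝ}
    (hν : IsInvariantMeasure P ν) {f : V → ℝ}
    (hf : MemLp f 2 (weightMeasure ν)) (x : V) :
    Summable fun y => P x y * f y := by
  let _ : MeasurableSpace V := ⊤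
  have h1 : ENNReal.ofReal (ν x) * (∑' y, ENNReal.ofReal (P x y) * ‖f y‖ₑ) ^ 2 < ∞ := by
    refine lt_of_le_of_lt (ENNReal.le_tsum x) (lt_of_le_of_lt (contraction_sq hP hν f) ?_)
    rw [← eLpNorm_weightMeasure_sq]
    exact ENNReal.pow_lt_top hf.2
  have h2 : (∑' y, ENNReal.ofReal (P x y) * ‖f y‖ₑ) ≠ ∞ := by
    intro h
    rw [h] at h1
    simp [ENNReal.mul_top, hν.pos x] at h1
  refine Summable.of_enorm (ne_of_eq_of_ne (tsum_congr fun y => ?_) h2)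
  rw [enorm_mul, Real.enorm_of_nonneg (hP.nonneg x y)]

/-- The transition operator of `P` as a bounded linear operator on `ℓ²(V, ν)`. -/
noncomputable def transitionOperator {P : V → V → ℝ} (hP : IsTransitionMatrix P) {ν : V → ℝ}
    (hν : IsInvariantMeasure P ν) : L2 ν →L[ℝ] L2 ν :=
  letI : MeasurableSpace V := ⊤
  LinearMap.mkContinuous
    { toFun := fun F => (memLp_act hP hν (Lp.memLp F)).toLp (act P F)
      map_add' := fun F H => by
        rw [← MemLp.toLp_add]
        congr 1
        have e := (ae_weightMeasure_iff hν.pos _).1 (Lp.coeFn_add F H)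
        ext x
        simp only [act, Pi.add_apply]
        rw [← (summable_act hP hν (Lp.memLp F) x).tsum_add
          (summable_act hP hν (Lp.memLp H) x)]
        refine tsum_congr fun y => ?_
        rw [e y, Pi.add_apply, mul_add]
      map_smul' := fun c F => by
        rw [RingHom.id_apply, ← MemLp.toLp_const_smul]
        congr 1
        have e := (ae_weightMeasure_iff hν.pos _).1 (Lp.coeFn_smul c F)
        ext x
        simp only [act, Pi.smul_apply, smul_eq_mul]
        rw [← tsum_mul_left]
        refine tsum_congr fun y => ?_
        rw [e y, Pi.smul_apply, smul_eq_mul]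
        ring }
    1 (fun F => by
      rw [one_mul, LinearMap.coe_mk, AddHom.coe_mk, Lp.norm_toLp, Lp.norm_def]
      exact ENNReal.toReal_mono (Lp.memLp F).2.ne (eLpNorm_act_le hP hν F))

/-- The transition operator is given by `PF(x) = ∑_y p(x,y) F(y)`. -/
theorem transitionOperator_apply {P : V → V → ℝ} (hP : IsTransitionMatrix P) {ν : V → ℝ}
    (hν : IsInvariantMeasure P ν) (F : L2 ν) (x : V) :
    transitionOperator hP hν F x = ∑' y, P x y * F y := by
  let _ : MeasurableSpace V := ⊤
  exact (ae_weightMeasure_iff hν.pos _).1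
    (MemLp.coeFn_toLp (memLp_act hP hν (Lp.memLp F))) x

/-- The squared norm of `ℓ²(V, ν)` is `∑_x F(x)² ν(x)`. -/
theorem norm_sq_L2 {ν : V → ℝ} (hν : ∀ x, 0 < ν x) (F : L2 ν) :
    HasSum (fun x => F x ^ 2 * ν x) (‖F‖ ^ 2) := by
  let _ : MeasurableSpace V := ⊤
  have h := eLpNorm_weightMeasure_sq ν F
  have hfin := ENNReal.pow_ne_top (n := 2) (Lp.memLp F).2.ne
  have key : ∀ x, (ENNReal.ofReal (ν x) * ‖F x‖ₑ ^ 2).toReal = F x ^ 2 * ν x := fun x => by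
    rw [ENNReal.toReal_mul, ENNReal.toReal_ofReal (hν x).le, ENNReal.toReal_pow, toReal_enorm,
      Real.norm_eq_abs, sq_abs, mul_comm]
  rw [Lp.norm_def, ← ENNReal.toReal_pow, h]
  rw [h] at hfin
  have hs := (ENNReal.summable_toReal hfin).hasSum
  rw [← ENNReal.tsum_toReal_eq (ENNReal.ne_top_of_tsum_ne_top hfin)] at hs
  simpa only [key] using hs

/-- The `ℓ²`-spectral radius `ρ₂(P) = lim_n ‖Pⁿ‖^{1/n}`. -/
noncomputable def l2SpectralRadius {P : V → V → ℝ} (hP : IsTransitionMatrix P) {ν : V → ℝ}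
    (hν : IsInvariantMeasure P ν) : ℝ :=
  limUnder atTop fun n : ℕ => ‖transitionOperator hP hν ^ n‖ ^ (1 / (n : ℝ))

end MarkovChains

end RandomWalkGraph

/-! Invariance of `ν` and Jensen's inequality make `P` a contraction, so the question is whether
`‖P^n‖` decays exponentially.

Amenable implies radius one: let `f` be the indicator of a finite set `F` with small boundary. By
bounded range, `Pf - f` lives within distance `R` of the boundary vertices of `F`, hence on few
points. So `f` is almost invariant, and telescoping with the contraction property gives `‖P^n‖ = 1`
for all `n`.

Radius one implies amenable: Gelfand's limit is an infimum, so `‖P^n‖ ≥ 1` for every `n ≥ 1`. Since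
`P` need not be self-adjoint, this does not at once produce a function of small energy. The remedy
is a square function: pick `f ≥ 0` with norm at most one whose iterates up to order `N + 1` stay
large, and set `g = (∑_{j ≤ N} (P^j f)²)^{1/2}`. Cauchy–Schwarz in `j` gives `⟨g, Pg⟩ ≥ ‖g‖² -
‖f‖²`, so the energy of `g` is at most `2‖f‖²`, whereas `‖g‖²` grows linearly in `N`
(`exists_energy_le`). Uniform irreducibility bounds the graph energy by a multiple of the energy of
`P` (`energy_iterate_le`). If the graph were not amenable, Cheeger's inequality
(`sq_mul_tsum_le_energy`) would bound the graph energy below by a multiple of `‖g‖²`, a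
contradiction for large `N`.

Energies count only the positive part of `g x - g y`, so truncated subtraction in `ℝ≥0∞` suffices
and summability questions disappear. -/

namespace RandomWalkGraph

/-! ### Nonnegative kernels and one-sided Dirichlet energies -/

section Kernels

variable {V : Type*}

theorem ennreal_two_mul_le_sq_add_sq (a b : ℝ≥0∞) : 2 * (a * b) ≤ a ^ 2 + b ^ 2 := by
  rcases eq_or_ne a ∞ with rfl | ha
  · simp
  rcases eq_or_ne b ∞ with rfl | hb
  · simp
  lift a to NNReal using ha
  lift b to NNReal using hb
  norm_cast
  rw [← NNReal.coe_le_coe]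
  push_cast
  nlinarith [sq_nonneg ((a : ℝ) - b)]

theorem ennreal_sub_sq_add_two_mul_le (a b : ℝ≥0∞) :
    (a - b) ^ 2 + 2 * (a * b) ≤ a ^ 2 + b ^ 2 := by
  rcases le_total a b with h | h
  · simpa [tsub_eq_zero_of_le h] using ennreal_two_mul_le_sq_add_sq a b
  rcases eq_or_ne a ∞ with rfl | ha
  · simp
  have hb : b ≠ ∞ := ne_top_of_le_ne_top ha h
  lift a to NNReal using ha
  lift b to NNReal using hb
  norm_cast at h ⊢
  rw [← NNReal.coe_le_coe]
  push_cast [NNReal.coe_sub h]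
  nlinarith

theorem ennreal_add_sq_le (a b : ℝ≥0∞) : (a + b) ^ 2 ≤ 2 * a ^ 2 + 2 * b ^ 2 := by
  calc (a + b) ^ 2 = a ^ 2 + b ^ 2 + 2 * (a * b) := by ring
    _ ≤ a ^ 2 + b ^ 2 + (a ^ 2 + b ^ 2) := by gcongr; exact ennreal_two_mul_le_sq_add_sq a b
    _ = _ := by ring

/-- A difference of squares, with truncated subtraction. -/
theorem ennreal_sq_sub_sq_le {a b : ℝ≥0∞} (hb : b ≠ ∞) :
    a ^ 2 - b ^ 2 ≤ (a - b) * (a + b) := by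
  rcases le_total a b with h | h
  · rw [tsub_eq_zero_of_le (pow_le_pow_left₀ zero_le h 2)]
    exact zero_le
  refine tsub_le_iff_right.2 (le_of_eq ?_)
  obtain ⟨d, rfl⟩ := exists_add_of_le h
  rw [ENNReal.add_sub_cancel_left hb]
  ring

/-- The one-sided Dirichlet sum of `g` with respect to the conductances `w`. -/
noncomputable def energy (w : V → V → ℝ≥0∞) (g : V → ℝ≥0∞) : ℝ≥0∞ :=
  ∑' x, ∑' y, w x y * (g x - g y) ^ 2

/-- The action of a nonnegative kernel on nonnegative functions. -/
noncomputable def kernelAct (p : V → V → ℝ≥0∞) (f : V → ℝ≥0∞) : V → ℝ≥0∞ :=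
  fun x => ∑' y, p x y * f y

theorem kernelAct_mono {p : V → V → ℝ≥0∞} {f g : V → ℝ≥0∞} (h : ∀ x, f x ≤ g x) (x : V) :
    kernelAct p f x ≤ kernelAct p g x :=
  ENNReal.tsum_le_tsum fun y => by gcongr; exact h y

theorem energy_mono {w w' : V → V → ℝ≥0∞} (h : ∀ x y, w x y ≤ w' x y) (g : V → ℝ≥0∞) :
    energy w g ≤ energy w' g :=
  ENNReal.tsum_le_tsum fun x => ENNReal.tsum_le_tsum fun y => by gcongr; exact h x y

theorem tsum_tsum_left_le {w : V → V → ℝ≥0∞} {m : V → ℝ≥0∞} (hw : ∀ x, ∑' y, w x y ≤ m x)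
    (f : V → ℝ≥0∞) : ∑' x, ∑' y, w x y * f x ≤ ∑' x, m x * f x :=
  ENNReal.tsum_le_tsum fun x => by rw [ENNReal.tsum_mul_right]; gcongr; exact hw x

theorem tsum_tsum_right_le {w : V → V → ℝ≥0∞} {m : V → ℝ≥0∞} (hw : ∀ y, ∑' x, w x y ≤ m y)
    (f : V → ℝ≥0∞) : ∑' x, ∑' y, w x y * f y ≤ ∑' x, m x * f x := by
  rw [ENNReal.tsum_comm]
  exact tsum_tsum_left_le (w := fun y x => w x y) hw f

/-- Expand the square: row sums control the terms `g x ^ 2`, subinvariance of `n` the terms `g y ^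
2`. This replaces the Dirichlet form identity of the reversible case. -/
theorem energy_add_le {p : V → V → ℝ≥0∞} {n : V → ℝ≥0∞} (hp : ∀ x, ∑' y, p x y ≤ 1)
    (hn : ∀ y, ∑' x, n x * p x y ≤ n y) (g : V → ℝ≥0∞) :
    energy (fun x y => n x * p x y) g + 2 * ∑' x, n x * (g x * kernelAct p g x)
      ≤ 2 * ∑' x, n x * g x ^ 2 := by
  have e : 2 * ∑' x, n x * (g x * kernelAct p g x)
      = ∑' x, ∑' y, n x * p x y * (2 * (g x * g y)) := by
    simp_rw [kernelAct, ← ENNReal.tsum_mul_left]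
    exact tsum_congr fun x => tsum_congr fun y => by ring
  have hl : ∀ x, ∑' y, n x * p x y ≤ n x := fun x => by
    rw [ENNReal.tsum_mul_left]
    exact mul_le_of_le_one_right zero_le (hp x)
  rw [e, energy, ← ENNReal.tsum_add]
  simp_rw [← ENNReal.tsum_add, ← mul_add]
  calc _ ≤ ∑' x, ∑' y, n x * p x y * (g x ^ 2 + g y ^ 2) :=
        ENNReal.tsum_le_tsum fun x => ENNReal.tsum_le_tsum fun y => by
          exact mul_le_mul_right (ennreal_sub_sq_add_two_mul_le _ _) _
    _ = (∑' x, ∑' y, n x * p x y * g x ^ 2) + ∑' x, ∑' y, n x * p x y * g y ^ 2 := by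
        simp_rw [mul_add, ENNReal.tsum_add]
    _ ≤ _ := by
        rw [two_mul]
        exact add_le_add (tsum_tsum_left_le hl fun x => g x ^ 2)
          (tsum_tsum_right_le hn fun x => g x ^ 2)

/-- Write one factor of each square as an average of the previous iterate over `y`, then apply
Cauchy–Schwarz in `j` for each fixed `y`. -/
theorem mul_kernelAct_sq_sum_ge (p : V → V → ℝ≥0∞) (f : V → ℝ≥0∞) (N : ℕ) (x : V) :
    ∑ j ∈ Finset.range N, ((kernelAct p)^[j + 1] f x) ^ 2
      ≤ (∑ j ∈ Finset.range (N + 1), ((kernelAct p)^[j] f x) ^ 2) ^ (1 / 2 : ℝ) *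
        kernelAct p (fun y => (∑ j ∈ Finset.range (N + 1), ((kernelAct p)^[j] f y) ^ 2) ^
          (1 / 2 : ℝ)) x := by
  set u : ℕ → V → ℝ≥0∞ := fun j => (kernelAct p)^[j] f with hu
  have hsucc : ∀ j, u (j + 1) x = ∑' y, p x y * u j y := fun j => by
    simp only [hu, Function.iterate_succ_apply']
    rfl
  change ∑ j ∈ Finset.range N, u (j + 1) x ^ 2 ≤
    (∑ j ∈ Finset.range (N + 1), u j x ^ 2) ^ (1 / 2 : ℝ) *
      ∑' y, p x y * (∑ j ∈ Finset.range (N + 1), u j y ^ 2) ^ (1 / 2 : ℝ)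
  calc ∑ j ∈ Finset.range N, u (j + 1) x ^ 2
      = ∑' y, p x y * ∑ j ∈ Finset.range N, u (j + 1) x * u j y := by
        simp_rw [Finset.mul_sum]
        rw [Summable.tsum_finsetSum fun _ _ => ENNReal.summable]
        refine Finset.sum_congr rfl fun j _ => ?_
        rw [sq]
        nth_rw 2 [hsucc]
        rw [← ENNReal.tsum_mul_left]
        exact tsum_congr fun y => by ring
    _ ≤ _ := by
        rw [← ENNReal.tsum_mul_left]
        refine ENNReal.tsum_le_tsum fun y => ?_
        rw [mul_left_comm]
        gcongr
        have h := ENNReal.inner_le_Lp_mul_Lq (Finset.range N) (fun j => u (j + 1) x)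
          (fun j => u j y) Real.HolderConjugate.two_two
        simp only [ENNReal.rpow_ofNat] at h
        refine h.trans ?_
        gcongr
        · rw [Finset.sum_range_succ' (fun j => u j x ^ 2)]
          exact le_self_add
        · exact Nat.le_succ N

/-- If the iterates of `f` stay large, the square function of the first iterates is almost
invariant. -/
theorem exists_energy_le {p : V → V → ℝ≥0∞} {n : V → ℝ≥0∞} (hp : ∀ x, ∑' y, p x y ≤ 1)
    (hn : ∀ y, ∑' x, n x * p x y ≤ n y) {f : V → ℝ≥0∞}
    (hf : ∀ j, ∑' x, n x * ((kernelAct p)^[j] f x) ^ 2 ≠ ∞) (N : ℕ) :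
    ∃ g : V → ℝ≥0∞,
      ∑' x, n x * g x ^ 2
        = ∑ j ∈ Finset.range (N + 1), ∑' x, n x * ((kernelAct p)^[j] f x) ^ 2 ∧
      energy (fun x y => n x * p x y) g ≤ 2 * ∑' x, n x * f x ^ 2 := by
  set g : V → ℝ≥0∞ := fun y =>
    (∑ j ∈ Finset.range (N + 1), ((kernelAct p)^[j] f y) ^ 2) ^ (1 / 2 : ℝ) with hg
  have hg2 : ∀ x, g x ^ 2 = ∑ j ∈ Finset.range (N + 1), ((kernelAct p)^[j] f x) ^ 2 := fun x => by
    rw [hg, ← ENNReal.rpow_natCast, ← ENNReal.rpow_mul]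
    norm_num
  have hsum : ∑' x, n x * g x ^ 2
      = ∑ j ∈ Finset.range (N + 1), ∑' x, n x * ((kernelAct p)^[j] f x) ^ 2 := by
    simp_rw [hg2, Finset.mul_sum]
    rw [Summable.tsum_finsetSum fun _ _ => ENNReal.summable]
  refine ⟨g, hsum, ?_⟩
  have h1 := energy_add_le hp hn g
  have h2 : ∑ j ∈ Finset.range N, ∑' x, n x * ((kernelAct p)^[j + 1] f x) ^ 2
      ≤ ∑' x, n x * (g x * kernelAct p g x) := by
    rw [← Summable.tsum_finsetSum fun _ _ => ENNReal.summable]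
    simp_rw [← Finset.mul_sum]
    exact ENNReal.tsum_le_tsum fun x => by
      gcongr; exact mul_kernelAct_sq_sum_ge p f N x
  -- The terms `j ≥ 1` of `‖g‖²` are finite and are absorbed by `⟨g, pg⟩`; only the term `j = 0`,
  -- which is `‖f‖²`, survives.
  rw [hsum, Finset.sum_range_succ', mul_add, add_comm (2 * _)] at h1
  have hfin : 2 * ∑ j ∈ Finset.range N, ∑' x, n x * ((kernelAct p)^[j + 1] f x) ^ 2 ≠ ∞ :=
    ENNReal.mul_ne_top (by norm_num) (ENNReal.sum_ne_top.2 fun j _ => hf (j + 1))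
  have h3 := (add_le_add_right (mul_le_mul_right h2 2) _).trans h1
  exact (ENNReal.add_le_add_iff_right hfin).1 h3

/-- Passing through the intermediate point `z` and using `(a + b)² ≤ 2a² + 2b²` gives `E (k + 1) ≤ 2
E₁ + 2 E k`, where `E k` is the energy of `q k` and `E₁` that of `p`; the factor `4 ^ k` is a crude
solution of this recursion. -/
theorem energy_iterate_le {p : V → V → ℝ≥0∞} {n : V → ℝ≥0∞} (hn : ∀ y, ∑' x, n x * p x y ≤ n y)
    {q : ℕ → V → V → ℝ≥0∞} (hq0 : ∀ x y, x ≠ y → q 0 x y = 0)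
    (hq1 : ∀ k x, ∑' y, q k x y ≤ 1)
    (hq : ∀ k x y, q (k + 1) x y ≤ ∑' z, p x z * q k z y) (g : V → ℝ≥0∞) (k : ℕ) :
    energy (fun x y => n x * q k x y) g ≤ 4 ^ k * energy (fun x y => n x * p x y) g := by
  induction k with
  | zero =>
    refine le_of_eq_of_le ?_ zero_le
    refine ENNReal.tsum_eq_zero.2 fun x => ENNReal.tsum_eq_zero.2 fun y => ?_
    rcases eq_or_ne x y with rfl | h
    · simp
    · simp [hq0 x y h]
  | succ k ih =>
    have key : energy (fun x y => n x * q (k + 1) x y) g ≤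
        2 * energy (fun x y => n x * p x y) g + 2 * energy (fun x y => n x * q k x y) g := by
      calc energy (fun x y => n x * q (k + 1) x y) g
          ≤ ∑' x, ∑' y, ∑' z, n x * p x z * q k z y *
              (2 * (g x - g z) ^ 2 + 2 * (g z - g y) ^ 2) := by
            refine ENNReal.tsum_le_tsum fun x => ENNReal.tsum_le_tsum fun y => ?_
            refine (mul_le_mul_left (mul_le_mul_right (hq k x y) _) _).trans ?_
            rw [← ENNReal.tsum_mul_left, ← ENNReal.tsum_mul_right]
            refine ENNReal.tsum_le_tsum fun z => ?_
            rw [← mul_assoc (n x)]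
            gcongr
            exact (pow_le_pow_left₀ zero_le tsub_le_tsub_add_tsub 2).trans
              (ennreal_add_sq_le _ _)
        _ = (∑' x, ∑' z, (∑' y, q k z y) * (n x * p x z * (2 * (g x - g z) ^ 2))) +
              ∑' z, ∑' y, (∑' x, n x * p x z) * (q k z y * (2 * (g z - g y) ^ 2)) := by
            simp_rw [mul_add, ENNReal.tsum_add]
            congr 1
            · refine tsum_congr fun x => ?_
              rw [ENNReal.tsum_comm]
              refine tsum_congr fun z => ?_
              rw [← ENNReal.tsum_mul_right]
              exact tsum_congr fun y => by ring
            · simp_rw [← ENNReal.tsum_mul_right]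
              have e : ∀ x, ∑' y, ∑' z, n x * p x z * q k z y * (2 * (g z - g y) ^ 2) =
                  ∑' z, ∑' y, n x * p x z * q k z y * (2 * (g z - g y) ^ 2) :=
                fun x => ENNReal.tsum_comm
              simp_rw [e]
              rw [ENNReal.tsum_comm]
              refine tsum_congr fun z => ?_
              rw [ENNReal.tsum_comm]
              exact tsum_congr fun y => tsum_congr fun x => by ring
        _ ≤ (∑' x, ∑' z, n x * p x z * (2 * (g x - g z) ^ 2)) +
              ∑' z, ∑' y, n z * (q k z y * (2 * (g z - g y) ^ 2)) := by
            refine add_le_add (ENNReal.tsum_le_tsum fun x => ENNReal.tsum_le_tsum fun z => ?_)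
              (ENNReal.tsum_le_tsum fun z => ENNReal.tsum_le_tsum fun y => ?_)
            · exact mul_le_of_le_one_left zero_le (hq1 k z)
            · exact mul_le_mul_left (hn z) _
        _ = _ := by
            simp_rw [energy, ← ENNReal.tsum_mul_left]
            congr 1 <;> exact tsum_congr fun x => tsum_congr fun y => by ring
    have h1 : (1 : ℝ≥0∞) ≤ 4 ^ k := one_le_pow₀ (by norm_num)
    calc _ ≤ _ := key
      _ ≤ 2 * (4 ^ k * energy (fun x y => n x * p x y) g)
          + 2 * (4 ^ k * energy (fun x y => n x * p x y) g) := by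
          gcongr
          exact le_mul_of_one_le_left zero_le h1
      _ = _ := by ring

/-! ### Coarea formula and Cheeger's inequality -/

theorem lintegral_indicator_Ioc_toReal {a b : ℝ≥0∞} (ha : a ≠ ∞) (hb : b ≠ ∞) :
    ∫⁻ t, (Set.Ioc b.toReal a.toReal).indicator 1 t = a - b := by
  rw [lintegral_indicator_one measurableSet_Ioc, Real.volume_Ioc,
    ENNReal.ofReal_sub _ ENNReal.toReal_nonneg, ENNReal.ofReal_toReal ha, ENNReal.ofReal_toReal hb]

/-- An isoperimetric inequality for finite sets implies the corresponding `ℓ¹` inequality for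
functions, by the coarea formula. -/
theorem mul_tsum_le_of_isoperimetric [Countable V] {w : V → V → ℝ≥0∞} {c : ℝ≥0∞}
    (hw : ∀ F : Finset V,
      c * F.card ≤ ∑' x, ∑' y, w x y * {z : V × V | z.1 ∈ F ∧ z.2 ∉ F}.indicator 1 (x, y))
    {h : V → ℝ≥0∞} (hh : ∑' x, h x ≠ ∞) :
    c * ∑' x, h x ≤ ∑' x, ∑' y, w x y * (h x - h y) := by
  have hfin := ENNReal.ne_top_of_tsum_ne_top hh
  have hI : ∀ a b : ℝ, Measurable ((Set.Ioc a b).indicator (1 : ℝ → ℝ≥0∞)) := fun a b =>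
    measurable_const.indicator measurableSet_Ioc
  have e1 : c * ∑' x, h x = ∫⁻ t, c * ∑' x, (Set.Ioc 0 (h x).toReal).indicator 1 t := by
    rw [lintegral_const_mul _ (Measurable.tsum fun x => hI _ _),
      lintegral_tsum fun x => (hI _ _).aemeasurable]
    congr 1
    refine tsum_congr fun x => ?_
    have := lintegral_indicator_Ioc_toReal (hfin x) ENNReal.zero_ne_top
    simpa using this.symm
  have hm : ∀ x y, Measurable fun t : ℝ =>
      w x y * (Set.Ioc (h y).toReal (h x).toReal).indicator (1 : ℝ → ℝ≥0∞) t := fun x y =>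
    (hI _ _).const_mul _
  have e2 : ∑' x, ∑' y, w x y * (h x - h y)
      = ∫⁻ t, ∑' x, ∑' y, w x y * (Set.Ioc (h y).toReal (h x).toReal).indicator 1 t := by
    rw [lintegral_tsum fun x => (Measurable.tsum fun y => hm x y).aemeasurable]
    refine tsum_congr fun x => ?_
    rw [lintegral_tsum fun y => (hm x y).aemeasurable]
    refine tsum_congr fun y => ?_
    rw [lintegral_const_mul _ (hI _ _),
      lintegral_indicator_Ioc_toReal (hfin x) (hfin y)]
  rw [e1, e2]
  refine lintegral_mono fun t => ?_
  rcases le_or_gt t 0 with ht | ht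
  · have : ∀ x, (Set.Ioc 0 (h x).toReal).indicator (1 : ℝ → ℝ≥0∞) t = 0 := fun x =>
      Set.indicator_of_notMem (fun hx => absurd hx.1 (not_lt.2 ht)) _
    simp [this]
  -- For `t > 0` the superlevel set of the summable `h` is finite, so the isoperimetric hypothesis
  -- applies to it; integrating over `t` gives the claim.
  · have hF : {x | ENNReal.ofReal t ≤ h x}.Finite :=
      ENNReal.finite_const_le_of_tsum_ne_top hh (by simpa using ht)
    have hmem : ∀ x, x ∈ hF.toFinset ↔ t ≤ (h x).toReal := fun x => by
      rw [Set.Finite.mem_toFinset, Set.mem_ofPred_eq, ENNReal.ofReal_le_iff_le_toReal (hfin x)]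
    refine le_of_eq_of_le ?_ ((hw hF.toFinset).trans_eq ?_)
    · congr 1
      rw [tsum_eq_sum (s := hF.toFinset)]
      · rw [Finset.sum_congr rfl (g := fun _ => 1)]
        · simp
        · intro x hx
          exact Set.indicator_of_mem (Set.mem_Ioc.2 ⟨ht, (hmem x).1 hx⟩) _
      · intro x hx
        exact Set.indicator_of_notMem (fun hx' => hx ((hmem x).2 hx'.2)) _
    · refine tsum_congr fun x => tsum_congr fun y => ?_
      congr 1
      simp only [Set.indicator, Set.mem_ofPred_eq, Set.mem_Ioc, hmem, not_le, Pi.one_apply]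
      exact if_congr and_comm rfl rfl

/-- Cheeger's inequality: an isoperimetric inequality bounds the energy from below. -/
theorem sq_mul_tsum_le_energy [Countable V] {w : V → V → ℝ≥0∞} {c M : ℝ≥0∞} (hc : c ≠ ∞)
    (hM0 : M ≠ 0) (hM : M ≠ ∞)
    (hw : ∀ F : Finset V,
      c * F.card ≤ ∑' x, ∑' y, w x y * {z : V × V | z.1 ∈ F ∧ z.2 ∉ F}.indicator 1 (x, y))
    (hrow : ∀ x, ∑' y, w x y ≤ M) (hcol : ∀ y, ∑' x, w x y ≤ M)
    {g : V → ℝ≥0∞} (hg : ∑' x, g x ^ 2 ≠ ∞) :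
    c ^ 2 * ∑' x, g x ^ 2 ≤ 4 * M * energy w g := by
  have hgfin : ∀ x, g x ≠ ∞ := fun x h => ENNReal.ne_top_of_tsum_ne_top hg x (by simp [h])
  set S := ∑' x, g x ^ 2 with hS
  have h1 : c * S ≤ ∑' x, ∑' y, w x y * ((g x - g y) * (g x + g y)) :=
    (mul_tsum_le_of_isoperimetric hw hg).trans <| ENNReal.tsum_le_tsum fun x =>
      ENNReal.tsum_le_tsum fun y => by gcongr; exact ennreal_sq_sub_sq_le (hgfin y)
  have h2 : ∑' x, ∑' y, w x y * (g x + g y) ^ 2 ≤ 4 * M * S := by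
    calc _ ≤ ∑' x, ∑' y, w x y * (2 * g x ^ 2 + 2 * g y ^ 2) :=
          ENNReal.tsum_le_tsum fun x => ENNReal.tsum_le_tsum fun y => by
            gcongr; exact ennreal_add_sq_le _ _
      _ = (∑' x, ∑' y, w x y * (2 * g x ^ 2)) + ∑' x, ∑' y, w x y * (2 * g y ^ 2) := by
          simp_rw [mul_add, ENNReal.tsum_add]
      _ ≤ (∑' x, M * (2 * g x ^ 2)) + ∑' x, M * (2 * g x ^ 2) :=
          add_le_add (tsum_tsum_left_le hrow fun x => 2 * g x ^ 2)
            (tsum_tsum_right_le hcol fun x => 2 * g x ^ 2)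
      _ = _ := by
          simp_rw [ENNReal.tsum_mul_left]
          ring
  -- AM–GM with the weights `4M` and `c`, chosen so that the second square contributes `4 M c² S`,
  -- exactly half of the lower bound `8 M c² S`, and can be cancelled.
  have h3 : 8 * M * c * ∑' x, ∑' y, w x y * ((g x - g y) * (g x + g y))
      ≤ 16 * M ^ 2 * energy w g + c ^ 2 * (4 * M * S) := by
    refine le_trans ?_ (add_le_add_right (mul_le_mul_right h2 _) _)
    simp_rw [energy, ← ENNReal.tsum_mul_left, ← ENNReal.tsum_add]
    refine ENNReal.tsum_le_tsum fun x => ENNReal.tsum_le_tsum fun y => ?_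
    calc _ = w x y * (2 * ((4 * M * (g x - g y)) * (c * (g x + g y)))) := by ring
      _ ≤ w x y * ((4 * M * (g x - g y)) ^ 2 + (c * (g x + g y)) ^ 2) := by
          gcongr; exact ennreal_two_mul_le_sq_add_sq _ _
      _ = _ := by ring
  have h4 : 4 * M * c ^ 2 * S + 4 * M * c ^ 2 * S
      ≤ 16 * M ^ 2 * energy w g + 4 * M * c ^ 2 * S := by
    calc _ = 8 * M * c * (c * S) := by ring
      _ ≤ _ := mul_le_mul_right h1 _
      _ ≤ _ := h3
      _ = _ := by ring
  have h5 := (ENNReal.add_le_add_iff_right (by finiteness)).1 h4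
  have h6 : 4 * M * (c ^ 2 * S) ≤ 4 * M * (4 * M * energy w g) := by
    convert h5 using 1 <;> ring
  exact (ENNReal.mul_le_mul_iff_right (by simp [hM0]) (by finiteness)).1 h6

end Kernels

/-! ### Counting vertices and edges in graphs of bounded degree -/

section Degrees

variable {α β : Type*} {G : Graph α β}

theorem finite_setOf_isLink (hfin : LocallyFinite G) (x y : α) : {e | G.IsLink e x y}.Finite :=
  (hfin x).subset fun _ he => Graph.IsLink.inc_left he

theorem finite_setOf_adj (hfin : LocallyFinite G) (x : G.vertexSet) :
    {y : G.vertexSet | G.Adj (x : α) y}.Finite := by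
  have h : {y : G.vertexSet | G.Adj (x : α) y} ⊆
      ⋃ e ∈ {e | G.Inc e (x : α)}, {y : G.vertexSet | G.IsLink e x y} := by
    rintro y ⟨e, he⟩
    exact Set.mem_biUnion (Graph.IsLink.inc_left he) he
  refine ((hfin x).biUnion fun e _ => Set.Subsingleton.finite ?_).subset h
  intro y hy z hz
  exact Subtype.ext (Graph.IsLink.right_unique hy hz)

theorem edgeCount_of_ne {x y : α} (h : x ≠ y) :
    edgeCount G x y = {e | G.IsLink e x y}.ncard := by
  simp [edgeCount, h]

theorem finite_support_edgeCount (hfin : LocallyFinite G) (x : G.vertexSet) :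
    (Function.support fun y : G.vertexSet => edgeCount G x y).Finite := by
  refine ((finite_setOf_adj hfin x).insert x).subset fun y hy => ?_
  rcases eq_or_ne y x with rfl | h
  · exact Set.mem_insert _ _
  right
  have hne : (x : α) ≠ y := fun h' => h (Subtype.ext h'.symm)
  rw [Function.mem_support, edgeCount_of_ne hne] at hy
  exact Set.nonempty_of_ncard_ne_zero hy

theorem one_le_edgeCount (hfin : LocallyFinite G) {x y : G.vertexSet}
    (h : (underlying G).Adj x y) : 1 ≤ edgeCount G x y := by
  rw [edgeCount_of_ne fun h' => h.1 (Subtype.ext h')]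
  exact (Set.ncard_pos (finite_setOf_isLink hfin _ _)).2 h.2

theorem sum_edgeCount_le_degree (hfin : LocallyFinite G) (x : G.vertexSet)
    (S : Finset G.vertexSet) : ∑ y ∈ S, edgeCount G x y ≤ degree G x := by
  classical
  rw [degree, finsum_eq_sum_of_support_subset (s := (finite_support_edgeCount hfin x).toFinset ∪ S)
    _ (by simp)]
  exact Finset.sum_le_sum_of_subset Finset.subset_union_right

theorem edgeCount_le_degree (hfin : LocallyFinite G) (x y : G.vertexSet) :
    edgeCount G x y ≤ degree G x := by
  simpa using sum_edgeCount_le_degree hfin x {y}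

theorem card_le_degree (hfin : LocallyFinite G) (x : G.vertexSet) {S : Finset G.vertexSet}
    (hS : ∀ y ∈ S, (underlying G).Adj x y) : S.card ≤ degree G x := by
  refine le_trans ?_ (sum_edgeCount_le_degree hfin x S)
  rw [Finset.card_eq_sum_ones]
  exact Finset.sum_le_sum fun y hy => one_le_edgeCount hfin (hS y hy)

theorem finite_setOf_underlying_adj (hfin : LocallyFinite G) (x : G.vertexSet) :
    {y | (underlying G).Adj x y}.Finite :=
  (finite_setOf_adj hfin x).subset fun _ h => And.right h

/-- The finite set of neighbours of a vertex. -/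
noncomputable def neighbors (hfin : LocallyFinite G) (x : G.vertexSet) : Finset G.vertexSet :=
  (finite_setOf_underlying_adj hfin x).toFinset

theorem mem_neighbors {hfin : LocallyFinite G} {x y : G.vertexSet} :
    y ∈ neighbors hfin x ↔ (underlying G).Adj x y := by
  rw [neighbors, Set.Finite.mem_toFinset, Set.mem_ofPred_eq]

/-- Balls of radius `r` have at most `(M + 1) ^ r` elements. -/
theorem exists_finset_walk_mem (hfin : LocallyFinite G) {M : ℕ} (hM : ∀ x, degree G x ≤ M)
    (r : ℕ) (x : G.vertexSet) : ∃ B : Finset G.vertexSet, B.card ≤ (M + 1) ^ r ∧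
      ∀ y, ∀ w : (underlying G).Walk x y, w.length ≤ r → y ∈ B := by
  classical
  induction r generalizing x with
  | zero =>
    refine ⟨{x}, by simp, fun y w hw => ?_⟩
    rw [Finset.mem_singleton]
    exact (SimpleGraph.Walk.eq_of_length_eq_zero (Nat.le_zero.1 hw)).symm
  | succ r ih =>
    choose B hB hB' using ih
    refine ⟨insert x ((neighbors hfin x).biUnion B), ?_, fun y w hw => ?_⟩
    · have h1 : ((neighbors hfin x).biUnion B).card ≤ M * (M + 1) ^ r :=
        (Finset.card_biUnion_le_card_mul _ _ _ fun y _ => hB y).trans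
          (Nat.mul_le_mul_right _
            ((card_le_degree hfin x fun y hy => mem_neighbors.1 hy).trans (hM x)))
      have h2 : 1 ≤ (M + 1) ^ r := Nat.one_le_pow _ _ (Nat.succ_pos M)
      calc _ ≤ _ := Finset.card_insert_le _ _
        _ ≤ M * (M + 1) ^ r + (M + 1) ^ r := add_le_add h1 h2
        _ = _ := by ring
    · cases w with
      | nil => exact Finset.mem_insert_self _ _
      | cons h p =>
        rw [SimpleGraph.Walk.length_cons] at hw
        exact Finset.mem_insert_of_mem
          (Finset.mem_biUnion.2 ⟨_, mem_neighbors.2 h, hB' _ _ p (by omega)⟩)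

/-- The balls about one vertex are finite and exhaust the graph. Countability serves the exchange of
sum and integral in the coarea formula. -/
theorem countable_vertexSet (hconn : (underlying G).Connected) (hfin : LocallyFinite G)
    {M : ℕ} (hM : ∀ x, degree G x ≤ M) : Countable G.vertexSet := by
  obtain ⟨x⟩ := hconn.nonempty
  choose B _ hB using fun r => exists_finset_walk_mem hfin hM r x
  have h : (Set.univ : Set G.vertexSet) ⊆ ⋃ r, (B r : Set G.vertexSet) := fun y _ => by
    obtain ⟨w⟩ := hconn.preconnected x y
    exact Set.mem_iUnion.2 ⟨w.length, hB _ y w le_rfl⟩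
  exact Set.countable_univ_iff.1
    ((Set.countable_iUnion fun r => (B r).countable_toSet).mono h)

/-- Take for `u` the last vertex before the walk first leaves `S`; the two walks are the parts of
`w` before and after it. -/
theorem exists_boundary_walk {V : Type*} {H : SimpleGraph V} {x y : V} (w : H.Walk x y)
    (S : Set V) (hx : x ∈ S) (hy : y ∉ S) :
    ∃ u ∈ S, (∃ v ∉ S, H.Adj u v) ∧ (∃ w' : H.Walk x u, w'.length ≤ w.length) ∧
      ∃ w' : H.Walk u y, w'.length ≤ w.length := by
  induction w with
  | nil => exact absurd hx hy
  | @cons x z y h p ih =>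
    by_cases hz : z ∈ S
    · obtain ⟨u, hu, hv, ⟨w', hw'⟩, w'', hw''⟩ := ih hz hy
      exact ⟨u, hu, hv, ⟨.cons h w', by simpa using hw'⟩, w'', by simpa using hw''.trans p.length.le_succ⟩
    · exact ⟨x, hx, ⟨z, hz, h⟩, ⟨.nil, by simp⟩, .cons h p, le_rfl⟩

theorem finite_boundary_edges (hfin : LocallyFinite G) (F : Finset G.vertexSet) :
    {e : β | ∃ x y : G.vertexSet, x ∈ F ∧ y ∉ F ∧ G.IsLink e x y}.Finite := by
  refine (F.finite_toSet.biUnion fun x _ => hfin x).subset ?_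
  rintro e ⟨x, y, hx, -, h⟩
  exact Set.mem_biUnion hx h.inc_left

/-- Vertices of `F` with a neighbour outside `F` are at most as many as the boundary edges. -/
theorem card_le_area (hfin : LocallyFinite G) (F : Finset G.vertexSet) {S : Finset G.vertexSet}
    (hS : ∀ u ∈ S, u ∈ F ∧ ∃ v ∉ F, (underlying G).Adj u v) : S.card ≤ area G F := by
  obtain rfl | ⟨u₀, hu₀⟩ := S.eq_empty_or_nonempty
  · simp
  have h : ∀ u ∈ S, ∃ e : β, ∃ v : G.vertexSet, v ∉ F ∧ G.IsLink e u v := fun u hu => by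
    obtain ⟨-, v, hv, -, e, he⟩ := hS u hu
    exact ⟨e, v, hv, he⟩
  have : Nonempty β := ⟨(h u₀ hu₀).choose⟩
  choose! f hf using h
  rw [area, ← Set.ncard_coe_finset]
  refine Set.ncard_le_ncard_of_injOn f (fun u hu => ?_) ?_ (finite_boundary_edges hfin F)
  · obtain ⟨v, hv, he⟩ := hf u hu
    exact ⟨u, v, (hS u hu).1, hv, he⟩
  · intro u hu u' hu' huu
    obtain ⟨v, hv, he⟩ := hf u hu
    obtain ⟨v', hv', he'⟩ := hf u' hu'
    rw [← huu] at he'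
    -- A boundary edge has only one endpoint in `F`, which makes the choice of edges injective.
    rcases he.left_eq_or_eq he' with h | h
    · exact Subtype.ext h
    · exact absurd (hS u hu).1 (Subtype.ext h ▸ hv')

theorem card_le_vol {F : Finset G.vertexSet} (h : ∀ x, 1 ≤ degree G x) : F.card ≤ vol G F := by
  rw [vol, Finset.card_eq_sum_ones]
  exact Finset.sum_le_sum fun x _ => h x

theorem vol_le {M : ℕ} (hM : ∀ x, degree G x ≤ M) (F : Finset G.vertexSet) :
    vol G F ≤ M * F.card := by
  rw [vol, mul_comm, ← smul_eq_mul]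
  exact Finset.sum_le_card_nsmul _ _ _ fun x _ => hM x

/-- Sort the boundary edges by their ordered pair of endpoints; at most `M` parallel edges join one
pair. -/
theorem area_le_sum (hfin : LocallyFinite G) {M : ℕ} (hM : ∀ x, degree G x ≤ M)
    (F : Finset G.vertexSet) :
    area G F ≤ ∑ x ∈ F, ∑ y ∈ neighbors hfin x, open Classical in if y ∈ F then 0 else M := by
  classical
  have hsub : {e : β | ∃ x y : G.vertexSet, x ∈ F ∧ y ∉ F ∧ G.IsLink e x y} ⊆
      ⋃ z ∈ F.sigma (fun x => (neighbors hfin x).filter (· ∉ F)),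
        {e | G.IsLink e (z.1 : α) z.2} := by
    rintro e ⟨x, y, hx, hy, h⟩
    simp only [Set.mem_iUnion, Set.mem_ofPred_eq]
    refine ⟨⟨x, y⟩, ?_, h⟩
    simp only [Finset.mem_sigma, Finset.mem_filter, mem_neighbors]
    exact ⟨hx, ⟨fun hxy => hy (hxy ▸ hx), ⟨e, h⟩⟩, hy⟩
  calc area G F ≤ _ := Set.ncard_le_ncard hsub
        ((Finset.finite_toSet _).biUnion fun z _ => finite_setOf_isLink hfin _ _)
    _ ≤ ∑ z ∈ F.sigma (fun x => (neighbors hfin x).filter (· ∉ F)),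
        {e | G.IsLink e (z.1 : α) z.2}.ncard := Finset.set_ncard_biUnion_le _ _
    _ = ∑ x ∈ F, ∑ y ∈ neighbors hfin x,
          if y ∈ F then 0 else {e | G.IsLink e (x : α) y}.ncard := by
        rw [Finset.sum_sigma]
        refine Finset.sum_congr rfl fun x _ => ?_
        rw [Finset.sum_filter]
        exact Finset.sum_congr rfl fun y _ => ite_not _ _ _
    _ ≤ _ := by
        refine Finset.sum_le_sum fun x hx => Finset.sum_le_sum fun y hy => ?_
        split_ifs with h
        · rfl
        · rw [← edgeCount_of_ne fun h' => h ((Subtype.ext h' : x = y) ▸ hx)]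
          exact (edgeCount_le_degree hfin x y).trans (hM x)

theorem area_eq_zero_of_vol_eq_zero (hfin : LocallyFinite G) (F : Finset G.vertexSet) (h : vol G F = 0) :
    area G F = 0 := by
  rw [area, Set.ncard_eq_zero (finite_boundary_edges hfin F), Set.eq_empty_iff_forall_notMem]
  rintro e ⟨x, y, hx, hy, he⟩
  have h1 := one_le_edgeCount (y := y) hfin ⟨fun hxy => hy (hxy ▸ hx), ⟨e, he⟩⟩
  have h2 : degree G x = 0 := Finset.sum_eq_zero_iff.1 h x hx
  have := edgeCount_le_degree hfin x y
  omega

/-! ### The isoperimetric constant -/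

theorem isoperimetricConstant_le {F : Finset G.vertexSet} (hF : F.Nonempty) :
    isoperimetricConstant G ≤ (area G F : ℝ) / vol G F := by
  refine csInf_le ⟨0, fun r hr => ?_⟩ ⟨F, hF, rfl⟩
  obtain ⟨F, -, rfl⟩ := hr
  exact div_nonneg (Nat.cast_nonneg _) (Nat.cast_nonneg _)

theorem isoperimetricConstant_nonneg : 0 ≤ isoperimetricConstant G := by
  refine Real.sInf_nonneg fun r hr => ?_
  obtain ⟨F, -, rfl⟩ := hr
  exact div_nonneg (Nat.cast_nonneg _) (Nat.cast_nonneg _)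

/-- In an amenable graph there are finite sets with small boundary. -/
theorem Amenable.exists_area_le (hfin : LocallyFinite G) [Nonempty G.vertexSet] {M : ℕ}
    (hM : ∀ x, degree G x ≤ M) (h : Amenable G) {δ : ℝ} (hδ : 0 < δ) :
    ∃ F : Finset G.vertexSet, F.Nonempty ∧ (area G F : ℝ) ≤ δ * M * F.card := by
  obtain ⟨x⟩ := ‹Nonempty G.vertexSet›
  have hlt : isoperimetricConstant G < δ := lt_of_eq_of_lt h hδ
  obtain ⟨r, hmem, hr⟩ := exists_lt_of_csInf_lt
    ⟨_, Set.mem_ofPred.2 ⟨{x}, Finset.singleton_nonempty x, rfl⟩⟩ hlt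
  obtain ⟨F, hF, rfl⟩ := hmem
  refine ⟨F, hF, ?_⟩
  have hv : (vol G F : ℝ) ≤ M * F.card := by exact_mod_cast vol_le hM F
  rcases Nat.eq_zero_or_pos (vol G F) with h0 | h0
  · rw [area_eq_zero_of_vol_eq_zero hfin F h0]
    rw [Nat.cast_zero]
    positivity
  · rw [div_lt_iff₀ (by exact_mod_cast h0)] at hr
    calc (area G F : ℝ) ≤ δ * vol G F := hr.le
      _ ≤ δ * (M * F.card) := by gcongr
      _ = _ := by ring

/-- In a non-amenable graph of bounded degree, the number of neighbouring pairs separated by a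
finite set is at least proportional to its cardinality. -/
theorem exists_isoperimetric_of_not_amenable (hfin : LocallyFinite G) [Nonempty G.vertexSet]
    {M : ℕ} (hM : ∀ x, degree G x ≤ M) (h : ¬ Amenable G) :
    ∃ c : ℝ, 0 < c ∧ ∀ F : Finset G.vertexSet, c * F.card ≤
      ∑ x ∈ F, ∑ y ∈ neighbors hfin x, open Classical in if y ∈ F then (0 : ℝ) else 1 := by
  have hpos : 0 < isoperimetricConstant G := lt_of_le_of_ne isoperimetricConstant_nonneg (Ne.symm h)
  -- A vertex of degree `0` would give the quotient `0 / 0 = 0` and make the graph amenable.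
  have hdeg : ∀ x, 1 ≤ degree G x := fun x => by
    by_contra hx
    have h0 : vol G {x} = 0 := by simpa [vol] using hx
    have := isoperimetricConstant_le (G := G) (Finset.singleton_nonempty x)
    rw [h0, Nat.cast_zero, div_zero] at this
    exact absurd this (not_le.2 hpos)
  have hM0 : (0 : ℝ) < M := by
    obtain ⟨x⟩ := ‹Nonempty G.vertexSet›
    exact_mod_cast (hdeg x).trans (hM x)
  refine ⟨isoperimetricConstant G / M, div_pos hpos hM0, fun F => ?_⟩
  obtain rfl | hF := F.eq_empty_or_nonempty
  · simp
  have hv : (F.card : ℝ) ≤ vol G F := by exact_mod_cast card_le_vol hdeg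
  have hc : (0 : ℝ) < F.card := by exact_mod_cast hF.card_pos
  have h1 := isoperimetricConstant_le (G := G) hF
  rw [le_div_iff₀ (hc.trans_le hv)] at h1
  have h2 : (area G F : ℝ) ≤ _ := Nat.cast_le.2 (area_le_sum hfin hM F)
  push_cast at h2
  rw [div_mul_eq_mul_div, div_le_iff₀ hM0, Finset.sum_mul]
  refine (mul_le_mul_of_nonneg_left hv hpos.le).trans (h1.trans (h2.trans_eq ?_))
  refine Finset.sum_congr rfl fun x _ => ?_
  rw [Finset.sum_mul]
  refine Finset.sum_congr rfl fun y _ => ?_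
  split_ifs <;> simp

end Degrees

/-! ### The spectral radius and iterates of the transition operator -/

section Operators

/-- Gelfand's limit exists in every real normed algebra, and is the infimum of the sequence. -/
theorem exists_tendsto_norm_pow_rpow {A : Type*} [NormedRing A] [NormedAlgebra ℝ A]
    (h1 : ‖(1 : A)‖ ≤ 1) (a : A) :
    ∃ L : ℝ, Tendsto (fun n : ℕ => ‖a ^ n‖ ^ (1 / (n : ℝ))) atTop (𝓝 L) ∧
      ∀ n : ℕ, 0 < n → L ≤ ‖a ^ n‖ ^ (1 / (n : ℝ)) := by
  have hcomm : ∀ b ∈ ({a} : Set A), ∀ c ∈ ({a} : Set A), b * c = c * b := by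
    rintro b rfl c rfl
    rfl
  have := Algebra.isMulCommutative_adjoin ℝ hcomm
  let μ : RingSeminorm (Algebra.adjoin ℝ {a}) :=
    { toFun := fun x => ‖(x : A)‖
      map_zero' := norm_zero
      add_le' := fun x y => norm_add_le (x : A) y
      neg' := fun x => norm_neg (x : A)
      mul_le' := fun x y => norm_mul_le (x : A) y }
  let x : Algebra.adjoin ℝ {a} := ⟨a, Algebra.self_mem_adjoin_singleton ℝ a⟩
  exact ⟨smoothingFun μ x, tendsto_smoothingFun_of_map_one_le_one μ h1 x,
    fun n hn => smoothingFun_le μ x ⟨n, hn⟩⟩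

variable {V : Type*} {P : V → V → ℝ} {ν : V → ℝ}

theorem exists_tendsto_l2SpectralRadius (hP : IsTransitionMatrix P) (hν : IsInvariantMeasure P ν) :
    Tendsto (fun n : ℕ => ‖transitionOperator hP hν ^ n‖ ^ (1 / (n : ℝ))) atTop
        (𝓝 (l2SpectralRadius hP hν)) ∧
      ∀ n : ℕ, 0 < n → l2SpectralRadius hP hν ≤ ‖transitionOperator hP hν ^ n‖ ^ (1 / (n : ℝ)) := by
  obtain ⟨L, hL, hle⟩ := exists_tendsto_norm_pow_rpow ContinuousLinearMap.norm_id_le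
    (transitionOperator hP hν)
  have : l2SpectralRadius hP hν = L := hL.limUnder_eq
  rw [this]
  exact ⟨hL, hle⟩

theorem norm_transitionOperator_le (hP : IsTransitionMatrix P) (hν : IsInvariantMeasure P ν) :
    ‖transitionOperator hP hν‖ ≤ 1 :=
  LinearMap.mkContinuous_norm_le _ zero_le_one _

theorem norm_transitionOperator_apply_le (hP : IsTransitionMatrix P)
    (hν : IsInvariantMeasure P ν) (F : L2 ν) : ‖transitionOperator hP hν F‖ ≤ ‖F‖ :=
  (ContinuousLinearMap.le_of_opNorm_le _ (norm_transitionOperator_le hP hν) F).trans_eq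
    (one_mul _)

/-- Telescoping: each of the `n` increments `T^j (TF - F)` has norm at most `‖TF - F‖`. -/
theorem norm_transitionOperator_pow_apply_sub_le (hP : IsTransitionMatrix P)
    (hν : IsInvariantMeasure P ν) (F : L2 ν) (n : ℕ) :
    ‖(transitionOperator hP hν ^ n) F - F‖ ≤ n * ‖transitionOperator hP hν F - F‖ := by
  induction n with
  | zero => simp
  | succ n ih =>
    set T := transitionOperator hP hν
    have e : (T ^ (n + 1)) F - F = T ((T ^ n) F - F) + (T F - F) := by
      rw [pow_succ', mul_apply_eq_comp, map_sub]
      abel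
    rw [e]
    calc _ ≤ ‖T ((T ^ n) F - F)‖ + ‖T F - F‖ := norm_add_le _ _
      _ ≤ n * ‖T F - F‖ + ‖T F - F‖ := by
        gcongr
        exact (norm_transitionOperator_apply_le hP hν _).trans ih
      _ = _ := by push_cast; ring

/-- Almost invariant vectors force the `ℓ²`-spectral radius to be `1`. -/
theorem l2SpectralRadius_eq_one_of_almost_invariant (hP : IsTransitionMatrix P)
    (hν : IsInvariantMeasure P ν)
    (h : ∀ ε : ℝ, 0 < ε → ∃ F : L2 ν, 0 < ‖F‖ ∧ ‖transitionOperator hP hν F - F‖ ≤ ε * ‖F‖) :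
    l2SpectralRadius hP hν = 1 := by
  have hnorm : ∀ n : ℕ, ‖transitionOperator hP hν ^ n‖ = 1 := fun n => by
    refine le_antisymm ?_ ?_
    · rcases Nat.eq_zero_or_pos n with rfl | hn
      · exact ContinuousLinearMap.norm_id_le
      · exact (norm_pow_le' _ hn).trans
          (pow_le_one₀ (norm_nonneg _) (norm_transitionOperator_le hP hν))
    · refine le_of_forall_pos_le_add fun δ hδ => ?_
      obtain ⟨F, hF, hF'⟩ := h (δ / (n + 1)) (by positivity)
      have h1 := norm_transitionOperator_pow_apply_sub_le hP hν F n
      have h2 : (n : ℝ) * (δ / (n + 1) * ‖F‖) ≤ δ * ‖F‖ := by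
        rw [← mul_assoc]
        gcongr
        rw [mul_div_assoc', div_le_iff₀ (by positivity)]
        nlinarith
      have h3 : (n : ℝ) * ‖transitionOperator hP hν F - F‖ ≤ n * (δ / (n + 1) * ‖F‖) := by gcongr
      have h4 : ‖F‖ ≤ ‖(transitionOperator hP hν ^ n) F‖
          + ‖(transitionOperator hP hν ^ n) F - F‖ := by
        have := norm_sub_le ((transitionOperator hP hν ^ n) F)
          ((transitionOperator hP hν ^ n) F - F)
        rwa [sub_sub_cancel] at this
      have h5 := (transitionOperator hP hν ^ n).le_opNorm F
      refine le_of_mul_le_mul_right ?_ hF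
      rw [add_mul, one_mul]
      linarith
  have := (exists_tendsto_l2SpectralRadius hP hν).1
  simp only [hnorm, Real.one_rpow] at this
  exact tendsto_nhds_unique this tendsto_const_nhds

theorem one_le_norm_pow_of_l2SpectralRadius_eq_one (hP : IsTransitionMatrix P)
    (hν : IsInvariantMeasure P ν) (h : l2SpectralRadius hP hν = 1) (n : ℕ) (hn : 0 < n) :
    1 ≤ ‖transitionOperator hP hν ^ n‖ := by
  have h1 := (exists_tendsto_l2SpectralRadius hP hν).2 n hn
  rw [h] at h1
  by_contra hlt
  exact absurd h1 (not_le.2 (Real.rpow_lt_one (norm_nonneg _) (not_le.1 hlt) (by positivity)))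

theorem ofReal_norm_sq_L2 (ν : V → ℝ) (F : L2 ν) :
    ENNReal.ofReal ‖F‖ ^ 2 = ∑' x, ENNReal.ofReal (ν x) * ‖F x‖ₑ ^ 2 := by
  let _ : MeasurableSpace V := ⊤
  rw [← eLpNorm_weightMeasure_sq, Lp.norm_def, ENNReal.ofReal_toReal (Lp.memLp F).2.ne]

/-- The transition matrix as an extended nonnegative kernel. -/
noncomputable def ennrealKernel (P : V → V → ℝ) : V → V → ℝ≥0∞ := fun x y => ENNReal.ofReal (P x y)

theorem tsum_ennrealKernel (hP : IsTransitionMatrix P) (x : V) :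
    ∑' y, ennrealKernel P x y = 1 := by
  simp only [ennrealKernel]
  rw [← ENNReal.ofReal_tsum_of_nonneg (hP.nonneg x) (hP.hasSum_one x).summable,
    (hP.hasSum_one x).tsum_eq, ENNReal.ofReal_one]

theorem tsum_mul_ennrealKernel (hP : IsTransitionMatrix P) (hν : IsInvariantMeasure P ν) (y : V) :
    ∑' x, ENNReal.ofReal (ν x) * ennrealKernel P x y = ENNReal.ofReal (ν y) := by
  simp only [ennrealKernel, ← ENNReal.ofReal_mul (hν.pos _).le]
  rw [← ENNReal.ofReal_tsum_of_nonneg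
    (fun x => mul_nonneg (hν.pos x).le (hP.nonneg x y)) (hν.hasSum y).summable,
    (hν.hasSum y).tsum_eq]

/-- Positivity of the kernel allows replacing `F` by `|F|`, so the rest can be done with nonnegative
functions. -/
theorem enorm_transitionOperator_pow_apply_le (hP : IsTransitionMatrix P)
    (hν : IsInvariantMeasure P ν) (F : L2 ν) (n : ℕ) (x : V) :
    ‖(transitionOperator hP hν ^ n) F x‖ₑ
      ≤ (kernelAct (ennrealKernel P))^[n] (fun y => ‖F y‖ₑ) x := by
  induction n generalizing x with
  | zero => simp
  | succ n ih =>
    rw [pow_succ', mul_apply_eq_comp, transitionOperator_apply,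
      Function.iterate_succ_apply']
    exact (enorm_act_le hP _ x).trans (kernelAct_mono ih x)

theorem tsum_iterate_kernelAct_le (hP : IsTransitionMatrix P) (hν : IsInvariantMeasure P ν)
    {f : V → ℝ≥0∞} (hf : ∑' x, ENNReal.ofReal (ν x) * f x ^ 2 ≠ ∞) (n : ℕ) :
    ∑' x, ENNReal.ofReal (ν x) * ((kernelAct (ennrealKernel P))^[n] f x) ^ 2
      ≤ ∑' x, ENNReal.ofReal (ν x) * f x ^ 2 := by
  induction n with
  | zero => simp
  | succ n ih =>
    refine le_trans ?_ ih
    set u := (kernelAct (ennrealKernel P))^[n] f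
    have hu : ∀ x, u x ≠ ∞ := fun x hx => by
      refine ENNReal.ne_top_of_tsum_ne_top (ne_top_of_le_ne_top hf ih) x ?_
      rw [hx]
      simp [ENNReal.mul_top, hν.pos x]
    have hu' : ∀ x, ‖(u x).toReal‖ₑ = u x := fun x => by
      rw [Real.enorm_of_nonneg ENNReal.toReal_nonneg, ENNReal.ofReal_toReal (hu x)]
    have h := contraction_sq hP hν fun x => (u x).toReal
    simp only [hu'] at h
    rw [Function.iterate_succ_apply']
    exact h

/-- If the `ℓ²`-spectral radius is `1`, there are functions of small energy. -/
theorem exists_energy_le_of_l2SpectralRadius_eq_one (hP : IsTransitionMatrix P)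
    (hν : IsInvariantMeasure P ν) (h : l2SpectralRadius hP hν = 1) (N : ℕ) :
    ∃ g : V → ℝ≥0∞, ∑' x, ENNReal.ofReal (ν x) * g x ^ 2 ≠ ∞ ∧
      ∑' x, ENNReal.ofReal (ν x) * g x ^ 2 ≠ 0 ∧
      N * energy (fun x y => ENNReal.ofReal (ν x) * ennrealKernel P x y) g
        ≤ 4 * ∑' x, ENNReal.ofReal (ν x) * g x ^ 2 := by
  -- Any `r < 1` with `2r² ≥ 1` would do; `3 / 4` yields `1 ≤ 2 * A (N + 1)` below.
  obtain ⟨F, hF1, hF⟩ := ContinuousLinearMap.exists_lt_apply_of_lt_opNorm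
    (transitionOperator hP hν ^ (N + 1))
    (r := 3 / 4) (lt_of_lt_of_le (by norm_num)
      (one_le_norm_pow_of_l2SpectralRadius_eq_one hP hν h (N + 1) N.succ_pos))
  set n : V → ℝ≥0∞ := fun x => ENNReal.ofReal (ν x)
  set f : V → ℝ≥0∞ := fun x => ‖F x‖ₑ with hf
  set A : ℕ → ℝ≥0∞ := fun j => ∑' x, n x * ((kernelAct (ennrealKernel P))^[j] f x) ^ 2 with hA
  have hA0 : A 0 = ENNReal.ofReal ‖F‖ ^ 2 := (ofReal_norm_sq_L2 ν F).symm
  have hA0' : A 0 ≤ 1 := by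
    rw [hA0, ← ENNReal.ofReal_pow (norm_nonneg _)]
    exact ENNReal.ofReal_le_one.2 (pow_le_one₀ (norm_nonneg _) hF1.le)
  have hfin : ∑' x, n x * f x ^ 2 ≠ ∞ := ne_top_of_le_ne_top ENNReal.one_ne_top hA0'
  have hAanti : ∀ j, A j ≤ A 0 := tsum_iterate_kernelAct_le hP hν hfin
  have hAsucc : ∀ j, A (j + 1) ≤ A j := fun j => by
    have := tsum_iterate_kernelAct_le hP hν (ne_top_of_le_ne_top hfin (hAanti j)) 1
    simpa only [hA, n, Function.iterate_succ_apply', Function.iterate_zero_apply] using this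
  have hAmono : Antitone A := antitone_nat_of_succ_le hAsucc
  have hAlast : 1 ≤ 2 * A (N + 1) := by
    have h1 : ENNReal.ofReal ‖(transitionOperator hP hν ^ (N + 1)) F‖ ^ 2 ≤ A (N + 1) := by
      rw [ofReal_norm_sq_L2]
      exact ENNReal.tsum_le_tsum fun x => by
        gcongr; exact enorm_transitionOperator_pow_apply_le hP hν F (N + 1) x
    refine le_trans ?_ (mul_le_mul_right h1 2)
    have h0 := norm_nonneg ((transitionOperator hP hν ^ (N + 1)) F)
    generalize ‖(transitionOperator hP hν ^ (N + 1)) F‖ = r at hF h0 ⊢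
    rw [← ENNReal.ofReal_pow h0, ← ENNReal.ofReal_ofNat 2,
      ← ENNReal.ofReal_mul (by norm_num), ENNReal.one_le_ofReal]
    nlinarith
  obtain ⟨g, hg, hE⟩ := exists_energy_le (n := n) (fun x => (tsum_ennrealKernel hP x).le)
    (fun y => (tsum_mul_ennrealKernel hP hν y).le) (f := f)
    (fun j => ne_top_of_le_ne_top hfin (hAanti j)) N
  -- `‖g‖²` is the sum of `N + 1` terms of the decreasing sequence `A`, whereas the energy stays
  -- below `2 * A 0`.
  have hge : (N + 1 : ℕ) * A (N + 1) ≤ ∑' x, n x * g x ^ 2 := by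
    rw [hg, ← nsmul_eq_mul]
    have := Finset.card_nsmul_le_sum (Finset.range (N + 1)) A (A (N + 1))
      fun j hj => hAmono (Finset.mem_range.1 hj).le
    rwa [Finset.card_range] at this
  refine ⟨g, ?_, ?_, ?_⟩
  · rw [hg]
    exact ENNReal.sum_ne_top.2 fun j _ => ne_top_of_le_ne_top hfin (hAanti j)
  · intro h0
    rw [h0, nonpos_iff_eq_zero, mul_eq_zero] at hge
    rcases hge with h' | h'
    · exact absurd h' (by simp)
    · rw [h', mul_zero] at hAlast
      exact absurd hAlast (by simp)
  · calc N * energy (fun x y => n x * ennrealKernel P x y) g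
        ≤ N * (2 * A 0) := by gcongr; exact hE
      _ ≤ (N + 1 : ℕ) * (2 * (2 * A (N + 1))) := by
          gcongr
          · exact N.le_succ
          · exact hA0'.trans hAlast
      _ = 4 * ((N + 1 : ℕ) * A (N + 1)) := by ring
      _ ≤ _ := by gcongr

/-! ### Energies of the `n`-step kernels -/

theorem nStep_nonneg (hP : IsTransitionMatrix P) (k : ℕ) (x y : V) : 0 ≤ nStep P k x y := by
  induction k generalizing x with
  | zero => simp only [nStep]; split_ifs <;> norm_num
  | succ k ih => exact tsum_nonneg fun z => mul_nonneg (hP.nonneg x z) (ih z)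

theorem ofReal_nStep_succ_le (hP : IsTransitionMatrix P) (k : ℕ) (x y : V) :
    ENNReal.ofReal (nStep P (k + 1) x y)
      ≤ ∑' z, ennrealKernel P x z * ENNReal.ofReal (nStep P k z y) := by
  have h : ‖nStep P (k + 1) x y‖ₑ ≤ ∑' z, ‖P x z * nStep P k z y‖ₑ := enorm_tsum_le_tsum_enorm
  rw [Real.enorm_of_nonneg (nStep_nonneg hP _ _ _)] at h
  refine h.trans_eq (tsum_congr fun z => ?_)
  rw [enorm_mul, Real.enorm_of_nonneg (hP.nonneg x z), Real.enorm_of_nonneg (nStep_nonneg hP _ _ _)]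
  rfl

theorem tsum_ofReal_nStep_le_one (hP : IsTransitionMatrix P) (k : ℕ) (x : V) :
    ∑' y, ENNReal.ofReal (nStep P k x y) ≤ 1 := by
  induction k generalizing x with
  | zero =>
    rw [tsum_eq_single x]
    · simp [nStep]
    · intro y hy
      simp [nStep, hy.symm]
  | succ k ih =>
    calc _ ≤ ∑' y, ∑' z, ennrealKernel P x z * ENNReal.ofReal (nStep P k z y) :=
          ENNReal.tsum_le_tsum fun y => ofReal_nStep_succ_le hP k x y
      _ = ∑' z, ennrealKernel P x z * ∑' y, ENNReal.ofReal (nStep P k z y) := by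
          rw [ENNReal.tsum_comm]
          simp_rw [ENNReal.tsum_mul_left]
      _ ≤ ∑' z, ennrealKernel P x z * 1 := by gcongr with z; exact ih z
      _ = 1 := by simp_rw [mul_one]; exact tsum_ennrealKernel hP x

theorem energy_nStep_le (hP : IsTransitionMatrix P) (hν : IsInvariantMeasure P ν)
    (g : V → ℝ≥0∞) (k : ℕ) :
    energy (fun x y => ENNReal.ofReal (ν x) * ENNReal.ofReal (nStep P k x y)) g
      ≤ 4 ^ k * energy (fun x y => ENNReal.ofReal (ν x) * ennrealKernel P x y) g :=
  energy_iterate_le (q := fun k x y => ENNReal.ofReal (nStep P k x y))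
    (fun y => (tsum_mul_ennrealKernel hP hν y).le)
    (fun x y h => by simp [nStep, h]) (tsum_ofReal_nStep_le_one hP) (ofReal_nStep_succ_le hP) g k

end Operators

/-! ### Finitely supported functions and indicators -/

section FiniteSupport

variable {V : Type*} {P : V → V → ℝ} {ν : V → ℝ}

theorem exists_L2_eq_of_finite_support (hν : ∀ x, 0 < ν x) {f : V → ℝ} (S : Finset V)
    (hf : ∀ x ∉ S, f x = 0) : ∃ F : L2 ν, ∀ x, F x = f x := by
  let _ : MeasurableSpace V := ⊤
  have h : eLpNorm f 2 (weightMeasure ν) ^ 2 < ∞ := by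
    rw [eLpNorm_weightMeasure_sq, tsum_eq_sum (s := S) fun x hx => by simp [hf x hx]]
    exact ENNReal.sum_lt_top.2 fun x _ => by finiteness
  have hm : MemLp f 2 (weightMeasure ν) :=
    ⟨measurable_from_top.aestronglyMeasurable, by simpa using h⟩
  exact ⟨hm.toLp f, (ae_weightMeasure_iff hν _).1 hm.coeFn_toLp⟩

theorem norm_sq_L2_eq_sum (hν : ∀ x, 0 < ν x) (F : L2 ν) (S : Finset V)
    (hF : ∀ x ∉ S, F x = 0) : ‖F‖ ^ 2 = ∑ x ∈ S, F x ^ 2 * ν x := by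
  rw [← (norm_sq_L2 hν F).tsum_eq, tsum_eq_sum fun x hx => by simp [hF x hx]]

theorem act_indicator_mem_Icc (hP : IsTransitionMatrix P) (S : Set V) (x : V) :
    act P (S.indicator 1) x ∈ Set.Icc (0 : ℝ) 1 := by
  have h0 : ∀ y, 0 ≤ P x y * S.indicator 1 y := fun y =>
    mul_nonneg (hP.nonneg x y) (Set.indicator_nonneg (fun _ _ => zero_le_one) y)
  have h1 : ∀ y, P x y * S.indicator 1 y ≤ P x y := fun y =>
    mul_le_of_le_one_right (hP.nonneg x y)
      (Set.indicator_le_self' (f := 1) (fun _ _ => zero_le_one) y)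
  refine ⟨tsum_nonneg h0, ?_⟩
  rw [← (hP.hasSum_one x).tsum_eq]
  exact (Summable.of_nonneg_of_le h0 h1 (hP.hasSum_one x).summable).tsum_le_tsum h1
    (hP.hasSum_one x).summable

/-- If no step from `x` crosses the boundary of `S`, the average at `x` is that of a constant. -/
theorem act_indicator_eq (hP : IsTransitionMatrix P) (S : Set V) (x : V)
    (h : ∀ y, 0 < P x y → (y ∈ S ↔ x ∈ S)) : act P (S.indicator 1) x = S.indicator 1 x := by
  have e : ∀ y, P x y * S.indicator 1 y = P x y * S.indicator 1 x := fun y => by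
    rcases (hP.nonneg x y).eq_or_lt with h0 | h0
    · rw [← h0, zero_mul, zero_mul]
    · by_cases hx : x ∈ S
      · rw [Set.indicator_of_mem hx, Set.indicator_of_mem ((h y h0).2 hx)]
        rfl
      · rw [Set.indicator_of_notMem hx, Set.indicator_of_notMem fun hy => hx ((h y h0).1 hy)]
  rw [act, tsum_congr e, tsum_mul_right, (hP.hasSum_one x).tsum_eq, one_mul]

end FiniteSupport

/-! ### The two implications -/

section Main

variable {α β : Type*} {G : Graph α β} {P : G.vertexSet → G.vertexSet → ℝ} {ν : G.vertexSet → ℝ}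

theorem l2SpectralRadius_eq_one_of_amenable
    (hconn : (underlying G).Connected) (hfin : LocallyFinite G)
    {M : ℕ} (hM : ∀ x, degree G x ≤ M) (hP : IsTransitionMatrix P) (hrange : BoundedRange G P)
    (hν : IsInvariantMeasure P ν) {C : ℝ} (hC : 1 ≤ C) (hCν : ∀ x, C⁻¹ ≤ ν x ∧ ν x ≤ C)
    (h : Amenable G) : l2SpectralRadius hP hν = 1 := by
  classical
  have := hconn.nonempty
  have hC0 : 0 < C := zero_lt_one.trans_le hC
  obtain ⟨R, hR⟩ := hrange
  refine l2SpectralRadius_eq_one_of_almost_invariant hP hν fun ε hε => ?_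
  -- The boundary is counted with a factor `(M + 1) ^ R` for the balls, `M` for the degrees and `C`
  -- for each of the two comparisons of `ν` with counting measure; this `δ` absorbs them all.
  obtain ⟨F, hF, hFA⟩ := h.exists_area_le hfin hM
    (δ := ε ^ 2 / (C ^ 2 * (M + 1) ^ (R + 1))) (by positivity)
  choose B hB hB' using exists_finset_walk_mem hfin hM R
  set bd : Finset G.vertexSet := F.filter fun u => ∃ v ∉ F, (underlying G).Adj u v with hbd
  set U : Finset G.vertexSet := bd.biUnion B with hU
  have hUcard : (U.card : ℝ) ≤ area G F * (M + 1) ^ R := by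
    have h1 : U.card ≤ bd.card * (M + 1) ^ R :=
      Finset.card_biUnion_le_card_mul _ _ _ fun u _ => hB u
    have h2 : bd.card ≤ area G F :=
      card_le_area hfin F fun u hu => by simpa [hbd] using hu
    exact_mod_cast h1.trans (Nat.mul_le_mul_right _ h2)
  -- A geodesic from `a` to `b` leaves `F` at a vertex of `bd` within distance `R` of both ends.
  have hcross : ∀ a b, (underlying G).dist a b ≤ R → a ∈ F → b ∉ F → a ∈ U ∧ b ∈ U := by
    intro a b hab ha hb
    obtain ⟨w, hw⟩ := hconn.exists_walk_length_eq_dist a b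
    obtain ⟨u, hu, hv, ⟨w₁, hw₁⟩, w₂, hw₂⟩ := exists_boundary_walk w (F : Set G.vertexSet) ha hb
    have hubd : u ∈ bd := Finset.mem_filter.2 ⟨hu, hv⟩
    rw [hw] at hw₁ hw₂
    exact ⟨Finset.mem_biUnion.2 ⟨u, hubd, hB' u a w₁.reverse
        (by rw [SimpleGraph.Walk.length_reverse]; exact hw₁.trans hab)⟩,
      Finset.mem_biUnion.2 ⟨u, hubd, hB' u b w₂ (hw₂.trans hab)⟩⟩
  obtain ⟨f, hf⟩ := exists_L2_eq_of_finite_support hν.pos (f := (F : Set G.vertexSet).indicator 1) F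
    fun x hx => Set.indicator_of_notMem (by simpa using hx) _
  have hTf : ∀ x, (transitionOperator hP hν f - f) x =
      act P ((F : Set G.vertexSet).indicator 1) x - (F : Set G.vertexSet).indicator 1 x := fun x => by
    let _ : MeasurableSpace G.vertexSet := ⊤
    rw [(ae_weightMeasure_iff hν.pos _).1 (Lp.coeFn_sub (transitionOperator hP hν f) f) x,
      Pi.sub_apply, transitionOperator_apply, hf x]
    simp_rw [hf]
    rfl
  have hzero : ∀ x ∉ U, (transitionOperator hP hν f - f) x = 0 := by
    intro x hx
    rw [hTf, sub_eq_zero]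
    refine act_indicator_eq hP _ x fun y hxy => ?_
    have hd := hR x y hxy
    rw [Finset.mem_coe, Finset.mem_coe]
    constructor
    · intro hy
      by_contra hxF
      exact hx (hcross y x (by rwa [SimpleGraph.dist_comm]) hy hxF).2
    · intro hxF
      by_contra hy
      exact hx (hcross x y hd hxF hy).1
  have hsq : ∀ x, (transitionOperator hP hν f - f) x ^ 2 ≤ 1 := by
    intro x
    have h1 := act_indicator_mem_Icc hP (F : Set G.vertexSet) x
    rw [hTf, sq_le_one_iff_abs_le_one, abs_le]
    by_cases hx : x ∈ (F : Set G.vertexSet)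
    · rw [Set.indicator_of_mem hx, Pi.one_apply]
      constructor <;> linarith [h1.1, h1.2]
    · rw [Set.indicator_of_notMem hx]
      constructor <;> linarith [h1.1, h1.2]
  have hnum : ‖transitionOperator hP hν f - f‖ ^ 2 ≤ U.card * C := by
    rw [norm_sq_L2_eq_sum hν.pos _ U hzero, ← nsmul_eq_mul]
    refine Finset.sum_le_card_nsmul _ _ _ fun x _ => ?_
    exact (mul_le_of_le_one_left (hν.pos x).le (hsq x)).trans (hCν x).2
  have hden : F.card * C⁻¹ ≤ ‖f‖ ^ 2 := by
    rw [norm_sq_L2_eq_sum hν.pos f F fun x hx => by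
      rw [hf, Set.indicator_of_notMem (by simpa using hx)], ← nsmul_eq_mul]
    refine Finset.card_nsmul_le_sum _ _ _ fun x hx => ?_
    rw [hf, Set.indicator_of_mem (Finset.mem_coe.2 hx), Pi.one_apply, one_pow, one_mul]
    exact (hCν x).1
  have hcard : (0 : ℝ) < F.card := by exact_mod_cast hF.card_pos
  have hfpos : 0 < ‖f‖ ^ 2 := lt_of_lt_of_le (by positivity) hden
  have hfpos' : 0 < ‖f‖ := by
    rcases (norm_nonneg f).eq_or_lt with h0 | h0
    · rw [← h0] at hfpos
      norm_num at hfpos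
    · exact h0
  refine ⟨f, hfpos', ?_⟩
  refine (sq_le_sq₀ (norm_nonneg _) (mul_nonneg hε.le hfpos'.le)).1 ?_
  calc ‖transitionOperator hP hν f - f‖ ^ 2 ≤ U.card * C := hnum
    _ ≤ (ε ^ 2 / (C ^ 2 * (M + 1) ^ (R + 1)) * M * F.card * (M + 1) ^ R) * C := by
        gcongr
        exact hUcard.trans (by gcongr)
    _ = ε ^ 2 * (F.card * C⁻¹) * (M / (M + 1)) := by
        field_simp
        ring
    _ ≤ ε ^ 2 * (F.card * C⁻¹) * 1 := by
        gcongr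
        rw [div_le_one (by positivity)]
        linarith
    _ ≤ ε ^ 2 * ‖f‖ ^ 2 := by
        rw [mul_one]
        gcongr
    _ = _ := (mul_pow _ _ _).symm

theorem amenable_of_l2SpectralRadius_eq_one
    (hconn : (underlying G).Connected) (hfin : LocallyFinite G)
    {M : ℕ} (hM : ∀ x, degree G x ≤ M) (hP : IsTransitionMatrix P)
    (hirr : UniformlyIrreducible G P)
    (hν : IsInvariantMeasure P ν) {C : ℝ} (hC : 1 ≤ C) (hCν : ∀ x, C⁻¹ ≤ ν x ∧ ν x ≤ C)
    (h : l2SpectralRadius hP hν = 1) : Amenable G := by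
  classical
  by_contra hna
  have := hconn.nonempty
  have := countable_vertexSet hconn hfin hM
  have hC0 : 0 < C := zero_lt_one.trans_le hC
  obtain ⟨c, hc, hiso⟩ := exists_isoperimetric_of_not_amenable hfin hM hna
  obtain ⟨K, ε₀, hε₀, hK⟩ := hirr
  -- Unit conductances, ignoring multiplicities. Row sums are bounded by `M + 1` rather than `M`
  -- because Cheeger's inequality needs a nonzero bound.
  set w : G.vertexSet → G.vertexSet → ℝ≥0∞ := fun x y =>
    if (underlying G).Adj x y then 1 else 0 with hw
  have hrow : ∀ x, ∑' y, w x y ≤ (M + 1 : ℕ) := fun x => by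
    rw [tsum_eq_sum (s := neighbors hfin x)
      fun y hy => if_neg fun h => hy (mem_neighbors.2 h)]
    calc _ = ∑ y ∈ neighbors hfin x, (1 : ℝ≥0∞) :=
          Finset.sum_congr rfl fun y hy => if_pos (mem_neighbors.1 hy)
      _ = ((neighbors hfin x).card : ℝ≥0∞) := by simp
      _ ≤ _ := Nat.cast_le.2 (((card_le_degree hfin x fun y hy => mem_neighbors.1 hy).trans
          (hM x)).trans M.le_succ)
  have hsymm : ∀ x y, w x y = w y x := fun x y => by
    simp only [hw, SimpleGraph.adj_comm]
  have hcol : ∀ y, ∑' x, w x y ≤ (M + 1 : ℕ) := fun y => by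
    simp_rw [fun x => hsymm x y]
    exact hrow y
  have hisow : ∀ F : Finset G.vertexSet, ENNReal.ofReal c * F.card ≤
      ∑' x, ∑' y, w x y * {z : G.vertexSet × G.vertexSet | z.1 ∈ F ∧ z.2 ∉ F}.indicator 1 (x, y) := by
    intro F
    calc ENNReal.ofReal c * F.card
        = ENNReal.ofReal (c * F.card) := by rw [ENNReal.ofReal_mul hc.le, ENNReal.ofReal_natCast]
      _ ≤ _ := ENNReal.ofReal_le_ofReal (hiso F)
      _ = ∑ x ∈ F, ∑ y ∈ neighbors hfin x, w x y *
            {z : G.vertexSet × G.vertexSet | z.1 ∈ F ∧ z.2 ∉ F}.indicator 1 (x, y) := by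
          rw [ENNReal.ofReal_sum_of_nonneg fun x _ => Finset.sum_nonneg fun y _ => by
            split_ifs <;> norm_num]
          refine Finset.sum_congr rfl fun x hx => ?_
          rw [ENNReal.ofReal_sum_of_nonneg fun y _ => by split_ifs <;> norm_num]
          refine Finset.sum_congr rfl fun y hy => ?_
          rw [show w x y = 1 from if_pos (mem_neighbors.1 hy), one_mul]
          by_cases hyF : y ∈ F <;> simp [Set.indicator, hx, hyF]
      _ ≤ ∑ x ∈ F, ∑' y, w x y *
            {z : G.vertexSet × G.vertexSet | z.1 ∈ F ∧ z.2 ∉ F}.indicator 1 (x, y) :=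
          Finset.sum_le_sum fun x _ => ENNReal.sum_le_tsum _
      _ ≤ _ := ENNReal.sum_le_tsum _
  -- For neighbours, `ν x * nStep P k x y ≥ C⁻¹ * ε₀` for some `k ≤ K`. As `k` depends on the pair,
  -- `b` sums over all `k ≤ K`, with the factor `4 ^ k` of `energy_nStep_le`.
  set a : ℝ≥0∞ := ENNReal.ofReal (C / ε₀) with ha
  set b : ℝ≥0∞ := a * ∑ k ∈ Finset.range (K + 1), 4 ^ k with hb
  have hE : ∀ g, energy w g ≤
      b * energy (fun x y => ENNReal.ofReal (ν x) * ennrealKernel P x y) g := by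
    intro g
    have h1 : ∀ x y, w x y ≤ ∑ k ∈ Finset.range (K + 1),
        a * (ENNReal.ofReal (ν x) * ENNReal.ofReal (nStep P k x y)) := by
      intro x y
      by_cases hxy : (underlying G).Adj x y
      · rw [hw]
        simp only [hxy, if_true]
        obtain ⟨k, hk, hk'⟩ := hK x y hxy.2
        refine le_trans ?_ (Finset.single_le_sum (fun _ _ => zero_le)
          (Finset.mem_range.2 (Nat.lt_succ_of_le hk)))
        rw [← ENNReal.ofReal_mul (hν.pos x).le, ha, ← ENNReal.ofReal_mul (by positivity),
          ENNReal.one_le_ofReal]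
        calc (1 : ℝ) = C / ε₀ * (C⁻¹ * ε₀) := by field_simp
          _ ≤ _ := by
            have := hCν x
            gcongr
            · exact (hν.pos x).le
            · exact this.1
      · rw [hw]
        simp [hxy]
    calc energy w g ≤ _ := energy_mono h1 g
      _ = ∑ k ∈ Finset.range (K + 1), a *
            energy (fun x y => ENNReal.ofReal (ν x) * ENNReal.ofReal (nStep P k x y)) g := by
          simp_rw [energy, ← ENNReal.tsum_mul_left, Finset.sum_mul]
          rw [← Summable.tsum_finsetSum fun _ _ => ENNReal.summable]
          refine tsum_congr fun x => ?_
          rw [← Summable.tsum_finsetSum fun _ _ => ENNReal.summable]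
          exact tsum_congr fun y => Finset.sum_congr rfl fun k _ => mul_assoc _ _ _
      _ ≤ ∑ k ∈ Finset.range (K + 1), a * (4 ^ k *
            energy (fun x y => ENNReal.ofReal (ν x) * ennrealKernel P x y) g) := by
          gcongr with k
          exact energy_nStep_le hP hν g k
      _ = _ := by
          rw [hb, Finset.mul_sum, Finset.sum_mul]
          exact Finset.sum_congr rfl fun k _ => (mul_assoc _ _ _).symm
  have hbfin : b ≠ ∞ :=
    ENNReal.mul_ne_top ENNReal.ofReal_ne_top (ENNReal.sum_ne_top.2 fun k _ => by finiteness)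
  set M' : ℝ≥0∞ := ((M + 1 : ℕ) : ℝ≥0∞) with hM'
  have hM'fin : M' ≠ ∞ := ENNReal.natCast_ne_top _
  -- With `S = ∑ g²`, Cheeger's inequality, the comparison of energies and the energy bound for `g`
  -- combine to `N c² S ≤ 16 M' b C S`; `N` is chosen to violate this.
  obtain ⟨N, hN⟩ := ENNReal.exists_nat_mul_gt (a := ENNReal.ofReal c ^ 2)
    (b := 4 * M' * b * (4 * ENNReal.ofReal C))
    (pow_ne_zero 2 (by simpa using hc)) (by finiteness)
  obtain ⟨g, hgfin, hg0, hgE⟩ := exists_energy_le_of_l2SpectralRadius_eq_one hP hν h N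
  have hνle : ∑' x, ENNReal.ofReal (ν x) * g x ^ 2 ≤ ENNReal.ofReal C * ∑' x, g x ^ 2 := by
    rw [← ENNReal.tsum_mul_left]
    exact ENNReal.tsum_le_tsum fun x => by gcongr; exact (hCν x).2
  have hleν : ∑' x, g x ^ 2 ≤ ENNReal.ofReal C * ∑' x, ENNReal.ofReal (ν x) * g x ^ 2 := by
    rw [← ENNReal.tsum_mul_left]
    refine ENNReal.tsum_le_tsum fun x => ?_
    rw [← mul_assoc, ← ENNReal.ofReal_mul hC0.le]
    refine le_mul_of_one_le_left zero_le (ENNReal.one_le_ofReal.2 ?_)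
    calc (1 : ℝ) = C * C⁻¹ := (mul_inv_cancel₀ hC0.ne').symm
      _ ≤ _ := by gcongr; exact (hCν x).1
  have hSfin : ∑' x, g x ^ 2 ≠ ∞ := ne_top_of_le_ne_top (by finiteness) hleν
  have hS0 : ∑' x, g x ^ 2 ≠ 0 := fun h0 => by
    rw [h0, mul_zero] at hνle
    exact hg0 (nonpos_iff_eq_zero.1 hνle)
  have hmain := sq_mul_tsum_le_energy ENNReal.ofReal_ne_top (by simp [hM']) hM'fin hisow hrow hcol
    hSfin
  refine absurd hN (not_lt.2 ((ENNReal.mul_le_mul_iff_left hS0 hSfin).1 ?_))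
  calc N * ENNReal.ofReal c ^ 2 * ∑' x, g x ^ 2
      = N * (ENNReal.ofReal c ^ 2 * ∑' x, g x ^ 2) := mul_assoc _ _ _
    _ ≤ N * (4 * M' *
          (b * energy (fun x y => ENNReal.ofReal (ν x) * ennrealKernel P x y) g)) := by
        exact mul_le_mul_right (hmain.trans (mul_le_mul_right (hE g) _)) _
    _ = 4 * M' * b *
          (N * energy (fun x y => ENNReal.ofReal (ν x) * ennrealKernel P x y) g) := by ring
    _ ≤ 4 * M' * b * (4 * (ENNReal.ofReal C * ∑' x, g x ^ 2)) := by
        exact mul_le_mul_right (hgE.trans (mul_le_mul_right hνle _)) _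
    _ = _ := by ring

end Main

end RandomWalkGraph

theorem theorem3p4 {α β : Type*} (G : Graph α β)
    (hconn : (RandomWalkGraph.underlying G).Connected)
    (hfin : RandomWalkGraph.LocallyFinite G)
    (hdeg : ∃ M : ℕ, ∀ x : G.vertexSet, RandomWalkGraph.degree G x ≤ M)
    (P : G.vertexSet → G.vertexSet → ℝ)
    (hP : RandomWalkGraph.IsTransitionMatrix P)
    (hirr : RandomWalkGraph.UniformlyIrreducible G P)
    (hrange : RandomWalkGraph.BoundedRange G P)
    (ν : G.vertexSet → ℝ)
    (hν : RandomWalkGraph.IsInvariantMeasure P ν)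
    (hbound : ∃ C : ℝ, 1 ≤ C ∧ ∀ x, C⁻¹ ≤ ν x ∧ ν x ≤ C) :
    Tendsto (fun n : ℕ => ‖RandomWalkGraph.transitionOperator hP hν ^ n‖ ^ (1 / (n : ℝ))) atTop
        (𝓝 (RandomWalkGraph.l2SpectralRadius hP hν)) ∧
      (RandomWalkGraph.l2SpectralRadius hP hν = 1 ↔ RandomWalkGraph.Amenable G) := by
  obtain ⟨M, hM⟩ := hdeg
  obtain ⟨C, hC, hCν⟩ := hbound
  exact ⟨(RandomWalkGraph.exists_tendsto_l2SpectralRadius hP hν).1,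
    RandomWalkGraph.amenable_of_l2SpectralRadius_eq_one hconn hfin hM hP hirr hν hC hCν,
    RandomWalkGraph.l2SpectralRadius_eq_one_of_amenable hconn hfin hM hP hrange hν hC hCν⟩
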